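/- Let $\mathbb K$ be $\mathbb R$ or $\mathbb C$, let $\mathfrak g$ be a finite-dimensional Lie algebra over $\mathbb K$, and let $\mathcal G=(\mathfrak g,[\,,],\varpi,\varphi)$ be a Lie quasi-bialgebra, with $\varpi\colon\mathfrak g\to\bigwedge^2\mathfrak g$ and $\varphi\in\bigwedge^3\mathfrak g$; elements of $\bigwedge^2\mathfrak g$ are identified with skew maps $\mathfrak g^*\to\mathfrak g$. Explicitly, $\varpi$ is a Lie algebra $1$-cocycle, $\langle\xi\otimes\eta\otimes\zeta,\mathrm{ad}_x^{(3)}\varphi\rangle=\circlearrowleft_{\xi,\eta,\zeta}\langle\xi,\varpi_{\varpi_x\eta}\zeta\rangle$, and $\circlearrowleft_{\xi,\eta,\zeta}\bigl(\langle\zeta,\varpi_{\varphi(\xi,\eta)}\theta\rangle+\langle\xi,\varpi_{\varphi(\zeta,\theta)}\eta\rangle\bigr)=0$ for all $x\in\mathfrak g$, $\xi,\eta,\zeta,\theta\in\mathfrak g^*$, where $\varphi(\xi,\eta)=\langle\xi\otimes\eta\otimes1,\varphi\rangle\in\mathfrak g$ and $\circlearrowleft$ denotes the cyclic sum. Write $\langle\mathrm{ad}^*_x\xi,y\rangle=\langle\xi,[x,y]\rangle$.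 The double $\mathfrak d=\mathfrak g\oplus\mathfrak g^*$ is the Lie algebra containing $\mathfrak g$ as a subalgebra with $[x,\xi]=\varpi_x\xi-\mathrm{ad}^*_x\xi$ and $[\xi,\eta]=\varphi(\xi,\eta)-\langle\xi,\varpi_\bullet\eta\rangle$. Let $\mathfrak g=\mathfrak l\oplus\mathfrak m$ be a reductive decomposition ($\mathfrak l$ a subalgebra, $[\mathfrak l,\mathfrak m]\subset\mathfrak m$) such that $\varpi|_{\mathfrak l}=0$ and $\varphi\equiv0$ mod $\mathfrak l$ (that is, $\langle\xi\otimes\eta\otimes\zeta,\varphi\rangle=0$ for $\xi,\eta,\zeta\in\mathfrak l^\perp$). Let $p_{\mathfrak l}$ be the projection onto $\mathfrak l$ along $\mathfrak m$ (on $\mathfrak d$: along $\mathfrak m\oplus\mathfrak g^*$), $p_{\mathfrak g^*}$ the projection of $\mathfrak d$ onto $\mathfrak g^*$ along $\mathfrak g$, $s\colon\mathfrak l^*\to\mathfrak g^*$ the transpose of $p_{\mathfrak l}\colon\mathfrak g\to\mathfrak l$, and $i^*\colon\mathfrak g^*\to\mathfrak l^*$ the restriction. Let $\mathfrak g^\star_0=\mathfrak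 l\oplus\mathfrak l^\perp$, a Lie subalgebra of $\mathfrak d$. A map $l$ from an open subset of $\mathfrak l^*$ to $\bigwedge^2\mathfrak g$ is a dynamical $\ell$-matrix if $$\circlearrowleft_{\xi,\eta,\zeta}\bigl(\langle\zeta,d_pl(i^*\xi)\eta\rangle-\langle\zeta,[l_p\xi,l_p\eta]\rangle-\langle\zeta,\varpi_{l_p\xi}\eta\rangle\bigr)=\langle\xi\otimes\eta\otimes\zeta,\varphi\rangle,\qquad d_pl(\mathrm{ad}^*_zp)+\varpi_z+\mathrm{ad}_zl_p+l_p\mathrm{ad}^*_z=0\quad(z\in\mathfrak l).$$ The canonical $\ell$-matrix is the (germ at $0$ of) analytic dynamical $\ell$-matrix with $l_0=0$ and $l_p\,sp=0$. Let $U\subset\mathfrak l^*$ be a connected open neighbourhood of $0$ on which the canonical $\ell$-matrix $l$ is (i.e. extends to be) analytic, e.g. its domain of analyticity. Let $N(U)=U\times\mathfrak l\times\mathfrak g^*$, with anchor $a_p(z,\xi)=i^*\xi-\mathrm{ad}^*_zp$ and the bracket of sections whose value at $p$ is $$[(z,\xi),(z',\xi')]_p=\Bigl(d_pz'(a(z,\xi))-d_pz(a(z',\xi'))-[z,z']+\langle\xi,d_pl(\cdot)\xi'\rangle,\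 d_p\xi'(a(z,\xi))-d_p\xi(a(z',\xi'))+\mathrm{ad}^*_z\xi'-\mathrm{ad}^*_{z'}\xi+\langle\xi,\varpi_\bullet\xi'\rangle+\mathrm{ad}^*_{l_p\xi}\xi'-\mathrm{ad}^*_{l_p\xi'}\xi\Bigr);$$ this is the Lie algebroid of the dual of the dynamical Poisson groupoid defined by $l$. Let $U\times\mathfrak l^*\times\mathfrak g^\star_0$ be the trivial Lie algebroid on $U$ with vertex algebra $\mathfrak g_0^\star$: the anchor is the projection to $\mathfrak l^*$, and $[(\alpha,X),(\alpha',X')]_p=\bigl(d_p\alpha'(\alpha)-d_p\alpha(\alpha'),\,d_pX'(\alpha)-d_pX(\alpha')+[X,X']\bigr)$. Write $\mathrm{Ad}_{e^{sp}}=e^{\mathrm{ad}_{sp}}$ on $\mathfrak d$, $\tau_{t}(x+\xi)=x+t\xi+\xi$, and for $\alpha\in\mathfrak l^*$ $$u_p\alpha=p_{\mathfrak l}\,\tau_{-l_p}\frac{\mathrm{Ad}_{e^{sp}}-1}{\mathrm{ad}_{sp}}s\alpha,\qquad \sigma_p\alpha=p_{\mathfrak g^*}\frac{\mathrm{Ad}_{e^{sp}}-1}{\mathrm{ad}_{sp}}s\alpha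 .$$ **Theorem.** Both structures above are Lie algebroids, and the bundle map $T\colon U\times\mathfrak l^*\times\mathfrak g^\star_0\to N(U)=U\times\mathfrak l\times\mathfrak g^*$ over the identity of $U$ given by $$T_p(\alpha,z+\xi)=\bigl(u_p\alpha-p_{\mathfrak l}\tau_{-l_p}\mathrm{Ad}_{e^{sp}}(z+\xi),\ \sigma_p\alpha-p_{\mathfrak g^*}\mathrm{Ad}_{e^{sp}}(z+\xi)\bigr)\qquad(\alpha\in\mathfrak l^*,\ z\in\mathfrak l,\ \xi\in\mathfrak l^\perp)$$ is an isomorphism of Lie algebroids. -/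

import Mathlib

open scoped ContDiff Topology

noncomputable section

/-! ### Lie algebra structures on finite-dimensional normed spaces -/

/-- A Lie algebra structure on a normed space `V`. The bracket is a datum on `V` (and not a
`LieRing` instance) because `NormedAddCommGroup V` and `LieRing V` would put two unrelated
additions on `V`. -/
structure LieStructure (𝕜 V : Type*) [RCLike 𝕜] [NormedAddCommGroup V] [NormedSpace 𝕜 V] where
  bracket : V →L[𝕜] V →L[𝕜] V
  bracket_self : ∀ x, bracket x x = 0
  jacobi : ∀ x y z,
    bracket x (bracket y z) = bracket (bracket x y) z + bracket y (bracket x z)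

namespace LieStructure

variable {𝕜 V : Type*} [RCLike 𝕜] [NormedAddCommGroup V] [NormedSpace 𝕜 V]

theorem bracket_skew (A : LieStructure 𝕜 V) (x y : V) : A.bracket x y = -A.bracket y x := by
  have h := A.bracket_self (x + y)
  simp only [map_add, add_apply, A.bracket_self, zero_add, add_zero] at h
  exact eq_neg_of_add_eq_zero_right h

/-- `ad^*_x`, the transpose of `ad_x`: `⟨ad^*_x ξ, y⟩ = ⟨ξ, [x, y]⟩`. -/
def adStar (A : LieStructure 𝕜 V) (x : V) (ξ : StrongDual 𝕜 V) : StrongDual 𝕜 V :=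
  ξ.comp (A.bracket x)

@[simp]
theorem adStar_apply (A : LieStructure 𝕜 V) (x : V) (ξ : StrongDual 𝕜 V) (y : V) :
    A.adStar x ξ y = ξ (A.bracket x y) := rfl

/-- The Lie algebra structure induced on a Lie subalgebra `S`. -/
def restrict [FiniteDimensional 𝕜 V] (A : LieStructure 𝕜 V) (S : Submodule 𝕜 V)
    (hS : ∀ x ∈ S, ∀ y ∈ S, A.bracket x y ∈ S) : LieStructure 𝕜 S where
  bracket := LinearMap.toContinuousBilinearMap <|
    LinearMap.mk₂ 𝕜 (fun x y : S => (⟨A.bracket x y, hS x x.2 y y.2⟩ : S))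
      (by intros; ext; simp) (by intros; ext; simp) (by intros; ext; simp) (by intros; ext; simp)
  bracket_self x := by
    ext; simp [LinearMap.toContinuousBilinearMap_apply, A.bracket_self]
  jacobi x y z := by
    ext; simp [LinearMap.toContinuousBilinearMap_apply, A.jacobi (x : V) y z]

@[simp]
theorem coe_restrict_bracket [FiniteDimensional 𝕜 V] (A : LieStructure 𝕜 V) (S : Submodule 𝕜 V)
    (hS : ∀ x ∈ S, ∀ y ∈ S, A.bracket x y ∈ S) (x y : S) :
    ((A.restrict S hS).bracket x y : V) = A.bracket x y := rfl

end LieStructure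

/-! ### Lie quasi-bialgebras and their doubles -/

/-- A Lie quasi-bialgebra `(𝔤, [ , ], ϖ, φ)`. An element `t` of `⋀²𝔤` is regarded as a skew map
`𝔤* → 𝔤`, and `φ ∈ ⋀³𝔤` as the map `(ξ, η) ↦ φ(ξ, η, ·) ∈ 𝔤`, i.e.
`ζ (phi ξ η) = ⟨ξ ⊗ η ⊗ ζ, φ⟩`. -/
structure LieQuasiBialgebra (𝕜 𝔤 : Type*) [RCLike 𝕜] [NormedAddCommGroup 𝔤] [NormedSpace 𝕜 𝔤]
    extends LieStructure 𝕜 𝔤 where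
  varpi : 𝔤 →L[𝕜] StrongDual 𝕜 𝔤 →L[𝕜] 𝔤
  /-- `ϖ_x ∈ ⋀²𝔤`. -/
  varpi_skew : ∀ (x : 𝔤) (ξ η : StrongDual 𝕜 𝔤), ξ (varpi x η) = -η (varpi x ξ)
  phi : StrongDual 𝕜 𝔤 →L[𝕜] StrongDual 𝕜 𝔤 →L[𝕜] 𝔤
  /-- `φ` is alternating. -/
  phi_self : ∀ ξ : StrongDual 𝕜 𝔤, phi ξ ξ = 0
  phi_cyclic : ∀ ξ η ζ : StrongDual 𝕜 𝔤, ζ (phi ξ η) = ξ (phi η ζ)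
  /-- `ϖ` is a Lie algebra 1-cocycle with values in `⋀²𝔤`. -/
  varpi_cocycle : ∀ (x y : 𝔤) (ξ : StrongDual 𝕜 𝔤), varpi (bracket x y) ξ =
    (bracket x (varpi y ξ) + varpi y (toLieStructure.adStar x ξ))
      - (bracket y (varpi x ξ) + varpi x (toLieStructure.adStar y ξ))
  /-- Failure of the co-Jacobi identity:
  `⟨ξ ⊗ η ⊗ ζ, ad_x φ⟩` is the cyclic sum of `⟨ξ, ϖ_{ϖ_x η} ζ⟩`. -/
  coJacobi : ∀ (x : 𝔤) (ξ η ζ : StrongDual 𝕜 𝔤),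
    ζ (phi (toLieStructure.adStar x ξ) η) + ζ (phi ξ (toLieStructure.adStar x η))
        + toLieStructure.adStar x ζ (phi ξ η) =
      ξ (varpi (varpi x η) ζ) + η (varpi (varpi x ζ) ξ) + ζ (varpi (varpi x ξ) η)
  /-- `φ` is closed for the cobracket. -/
  phi_closed : ∀ ξ η ζ θ : StrongDual 𝕜 𝔤,
    (ζ (varpi (phi ξ η) θ) + ξ (varpi (phi ζ θ) η))
      + (ξ (varpi (phi η ζ) θ) + η (varpi (phi ξ θ) ζ))
      + (η (varpi (phi ζ ξ) θ) + ζ (varpi (phi η θ) ξ)) = 0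

namespace LieQuasiBialgebra

variable {𝕜 𝔤 : Type*} [RCLike 𝕜] [NormedAddCommGroup 𝔤] [NormedSpace 𝕜 𝔤]

/-- `⟨ξ, ϖ_• η⟩ ∈ 𝔤*`, that is `x ↦ ⟨ξ, ϖ_x η⟩`. -/
def coPair (Q : LieQuasiBialgebra 𝕜 𝔤) (ξ η : StrongDual 𝕜 𝔤) : StrongDual 𝕜 𝔤 :=
  ξ.comp (Q.varpi.flip η)

@[simp]
theorem coPair_apply (Q : LieQuasiBialgebra 𝕜 𝔤) (ξ η : StrongDual 𝕜 𝔤) (x : 𝔤) :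
    Q.coPair ξ η x = ξ (Q.varpi x η) := rfl

variable [FiniteDimensional 𝕜 𝔤]

/-- The bracket of the double `𝔡 = 𝔤 ⊕ 𝔤*`, as a bilinear map. -/
def doubleBracket (Q : LieQuasiBialgebra 𝕜 𝔤) :
    (𝔤 × StrongDual 𝕜 𝔤) →L[𝕜] (𝔤 × StrongDual 𝕜 𝔤) →L[𝕜] (𝔤 × StrongDual 𝕜 𝔤) :=
  LinearMap.toContinuousBilinearMap <| LinearMap.mk₂ 𝕜
    (fun X Y =>
      (Q.bracket X.1 Y.1 + Q.varpi X.1 Y.2 - Q.varpi Y.1 X.2 + Q.phi X.2 Y.2,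
        -Q.adStar X.1 Y.2 + Q.adStar Y.1 X.2 - Q.coPair X.2 Y.2))
    (by intros; ext <;> simp <;> abel)
    (by intros; ext <;> simp [smul_add, smul_sub])
    (by intros; ext <;> simp <;> abel)
    (by intros; ext <;> simp [smul_add, smul_sub])

theorem doubleBracket_apply (Q : LieQuasiBialgebra 𝕜 𝔤) (X Y : 𝔤 × StrongDual 𝕜 𝔤) :
    Q.doubleBracket X Y =
      (Q.bracket X.1 Y.1 + Q.varpi X.1 Y.2 - Q.varpi Y.1 X.2 + Q.phi X.2 Y.2,
        -Q.adStar X.1 Y.2 + Q.adStar Y.1 X.2 - Q.coPair X.2 Y.2) := rfl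

set_option linter.unusedSimpArgs false in
theorem doubleBracket_jacobi (Q : LieQuasiBialgebra 𝕜 𝔤) (X Y Z : 𝔤 × StrongDual 𝕜 𝔤) :
    Q.doubleBracket X (Q.doubleBracket Y Z) =
      Q.doubleBracket (Q.doubleBracket X Y) Z + Q.doubleBracket Y (Q.doubleBracket X Z) := by
  obtain ⟨x, ξ⟩ := X
  obtain ⟨y, η⟩ := Y
  obtain ⟨z, ζ⟩ := Z
  have hb : ∀ (θ : StrongDual 𝕜 𝔤) (a b : 𝔤), θ (Q.bracket a b) = -θ (Q.bracket b a) := by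
    intro θ a b
    rw [Q.bracket_skew, map_neg]
  have hj : ∀ (θ : StrongDual 𝕜 𝔤) (a b c : 𝔤), θ (Q.bracket a (Q.bracket b c)) =
      θ (Q.bracket (Q.bracket a b) c) + θ (Q.bracket b (Q.bracket a c)) := by
    intro θ a b c
    rw [Q.jacobi, map_add]
  have hp : ∀ (θ α β : StrongDual 𝕜 𝔤), θ (Q.phi α β) = -θ (Q.phi β α) := by
    intro θ α β
    have h := Q.phi_self (α + β)
    simp only [map_add, add_apply, Q.phi_self, zero_add, add_zero] at h
    rw [eq_neg_of_add_eq_zero_right h, map_neg]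
  have hc : ∀ (θ ρ : StrongDual 𝕜 𝔤) (a b : 𝔤), θ (Q.varpi (Q.bracket a b) ρ) =
      (θ (Q.bracket a (Q.varpi b ρ)) - ρ (Q.bracket a (Q.varpi b θ)))
        - (θ (Q.bracket b (Q.varpi a ρ)) - ρ (Q.bracket b (Q.varpi a θ))) := by
    intro θ ρ a b
    rw [Q.varpi_cocycle]
    simp only [map_add, map_sub]
    rw [Q.varpi_skew b θ, Q.varpi_skew a θ]
    simp only [LieStructure.adStar_apply]
    ring
  have hsw : ∀ α β : StrongDual 𝕜 𝔤, Q.phi α β = -Q.phi β α := by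
    intro α β
    have h := Q.phi_self (α + β)
    simp only [map_add, add_apply, Q.phi_self, zero_add, add_zero] at h
    exact eq_neg_of_add_eq_zero_right h
  have hf : ∀ (a : 𝔤) (α β ρ : StrongDual 𝕜 𝔤), ρ (Q.phi (Q.adStar a α) β) =
      α (Q.bracket a (Q.phi β ρ)) := by
    intro a α β ρ
    rw [Q.phi_cyclic]
    rfl
  have hf' : ∀ (a : 𝔤) (α β ρ : StrongDual 𝕜 𝔤), ρ (Q.phi α (Q.adStar a β)) =
      β (Q.bracket a (Q.phi ρ α)) := by
    intro a α β ρ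
    rw [← Q.phi_cyclic]
    rfl
  have hg : ∀ (α β γ ρ : StrongDual 𝕜 𝔤), ρ (Q.phi (Q.coPair α β) γ) =
      α (Q.varpi (Q.phi γ ρ) β) := by
    intro α β γ ρ
    rw [Q.phi_cyclic]
    rfl
  have hg' : ∀ (α β γ ρ : StrongDual 𝕜 𝔤), ρ (Q.phi γ (Q.coPair α β)) =
      α (Q.varpi (Q.phi ρ γ) β) := by
    intro α β γ ρ
    rw [← Q.phi_cyclic]
    rfl
  have hv : ∀ (a b : 𝔤) (α ρ : StrongDual 𝕜 𝔤), ρ (Q.varpi a (Q.adStar b α)) =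
      -α (Q.bracket b (Q.varpi a ρ)) := fun a b α ρ => Q.varpi_skew a ρ _
  have hv' : ∀ (a : 𝔤) (α β ρ : StrongDual 𝕜 𝔤), ρ (Q.varpi a (Q.coPair α β)) =
      -α (Q.varpi (Q.varpi a ρ) β) := fun a α β ρ => Q.varpi_skew a ρ _
  have hb₁ : ∀ (θ α : StrongDual 𝕜 𝔤) (a b : 𝔤), θ (Q.bracket (Q.varpi a α) b) =
      -θ (Q.bracket b (Q.varpi a α)) := fun θ α a b => hb θ _ _
  have hb₂ : ∀ (θ α β : StrongDual 𝕜 𝔤) (b : 𝔤), θ (Q.bracket (Q.phi α β) b) =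
      -θ (Q.bracket b (Q.phi α β)) := fun θ α β b => hb θ _ _
  ext w
  · apply (SeparatingDual.eq_iff_forall_dual_eq (R := 𝕜)).2
    intro θ
    have e1 := Q.coJacobi x η ζ θ
    have e2 := Q.coJacobi y ξ ζ θ
    have e3 := Q.coJacobi z ξ η θ
    have e4 := Q.phi_closed ξ η ζ θ
    simp only [doubleBracket_apply, Prod.fst_add, LieStructure.adStar_apply, map_add, map_sub,
      map_neg, add_apply, sub_apply, neg_apply, hf, hf', hg, hg', hv, hv', hc, hb₁, hb₂, hj θ x,
      hsw η ξ, hsw ζ ξ, hsw ζ η, hsw θ ξ, hsw θ η, hsw θ ζ,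
      fun a => Q.varpi_skew a η ξ, fun a => Q.varpi_skew a ζ ξ, fun a => Q.varpi_skew a ζ η,
      fun a => Q.varpi_skew a θ ξ, fun a => Q.varpi_skew a θ η,
      fun a => Q.varpi_skew a θ ζ] at e1 e2 e3 e4 ⊢
    linear_combination e1 - e2 + e3 + e4
  · simp only [doubleBracket_apply, Prod.snd_add, LieStructure.adStar_apply, coPair_apply, map_add,
      map_sub, map_neg, add_apply, sub_apply, neg_apply, hv, hv', hc, hb₁, hb₂, hj _ x,
      hsw η ξ, hsw ζ ξ, hsw ζ η,
      fun a => Q.varpi_skew a η ξ, fun a => Q.varpi_skew a ζ ξ, fun a => Q.varpi_skew a ζ η]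
    have e1 := Q.coJacobi w ξ η ζ
    simp only [doubleBracket_apply, Prod.snd_add, LieStructure.adStar_apply, coPair_apply, map_add,
      map_sub, map_neg, add_apply, sub_apply, neg_apply, hf, hf', hv, hv', hc, hb₁, hb₂, hj _ x,
      hsw η ξ, hsw ζ ξ, hsw ζ η,
      fun a => Q.varpi_skew a η ξ, fun a => Q.varpi_skew a ζ ξ, fun a => Q.varpi_skew a ζ η] at e1
    linear_combination -e1 - hj ξ y z w
/-- The double `𝔡 = 𝔤 ⊕ 𝔤*` of a Lie quasi-bialgebra: the Lie algebra with
`[x, y]_𝔡 = [x, y]`, `[x, ξ]_𝔡 = ϖ_x ξ - ad^*_x ξ`, and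
`[ξ, η]_𝔡 = ⟨ξ ⊗ η ⊗ 1, φ⟩ - ⟨ξ, ϖ_• η⟩`. -/
def double (Q : LieQuasiBialgebra 𝕜 𝔤) : LieStructure 𝕜 (𝔤 × StrongDual 𝕜 𝔤) where
  bracket := Q.doubleBracket
  bracket_self X := by
    rw [doubleBracket_apply]
    ext y
    · simp [Q.bracket_self, Q.phi_self]
    · have h := Q.varpi_skew y X.2 X.2
      have h' : X.2 (Q.varpi y X.2) = 0 := self_eq_neg.1 h
      simp [h']
  jacobi := Q.doubleBracket_jacobi

/-- A reductive decomposition `𝔤 = L ⊕ M` (`L` a Lie subalgebra, `[L, M] ⊆ M`) of a Lie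
quasi-bialgebra such that `ϖ` vanishes on `L` and `φ ≡ 0` modulo `L`. -/
structure ReductiveDecomposition (Q : LieQuasiBialgebra 𝕜 𝔤) where
  L : Submodule 𝕜 𝔤
  M : Submodule 𝕜 𝔤
  isCompl : IsCompl L M
  bracket_mem_L : ∀ z ∈ L, ∀ w ∈ L, Q.bracket z w ∈ L
  bracket_mem_M : ∀ z ∈ L, ∀ u ∈ M, Q.bracket z u ∈ M
  varpi_L : ∀ z ∈ L, Q.varpi z = 0
  /-- The image of `φ` in `⋀³(𝔤/L)` vanishes. -/
  phi_mod_L : ∀ ξ η ζ : StrongDual 𝕜 𝔤, (∀ z ∈ L, ξ z = 0) → (∀ z ∈ L, η z = 0) →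
    (∀ z ∈ L, ζ z = 0) → ζ (Q.phi ξ η) = 0

end LieQuasiBialgebra

/-! ### Lie algebroids on trivial bundles -/

/-- An anchor and a bracket of sections on the trivial bundle with fibre `F` over (an open subset
of) `E`. A section over `U` is given by a function `E → F`, of which only the values on `U` are
relevant. -/
structure AlgebroidData (𝕜 E F : Type*) [RCLike 𝕜] [NormedAddCommGroup E] [NormedSpace 𝕜 E]
    [NormedAddCommGroup F] [NormedSpace 𝕜 F] where
  anchor : E → F →L[𝕜] E
  bracket : (E → F) → (E → F) → E → F

section Algebroids

variable {𝕜 E F F' : Type*} [RCLike 𝕜] [NormedAddCommGroup E] [NormedSpace 𝕜 E]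
  [NormedAddCommGroup F] [NormedSpace 𝕜 F] [NormedAddCommGroup F'] [NormedSpace 𝕜 F']

/-- `A` is a (smooth) Lie algebroid structure on `U × F → U`, where the tangent bundle of the
open set `U ⊆ E` is `U × E`. -/
structure AlgebroidData.IsLieAlgebroid (A : AlgebroidData 𝕜 E F) (U : Set E) : Prop where
  anchor_smooth : ContDiffOn 𝕜 ∞ A.anchor U
  bracket_smooth : ∀ σ τ : E → F, ContDiffOn 𝕜 ∞ σ U → ContDiffOn 𝕜 ∞ τ U →
    ContDiffOn 𝕜 ∞ (A.bracket σ τ) U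
  /-- The bracket is well defined on sections over `U`. -/
  bracket_congr : ∀ σ σ' τ τ' : E → F, Set.EqOn σ σ' U → Set.EqOn τ τ' U →
    Set.EqOn (A.bracket σ τ) (A.bracket σ' τ') U
  bracket_add : ∀ σ τ ρ : E → F, ContDiffOn 𝕜 ∞ σ U → ContDiffOn 𝕜 ∞ τ U →
    ContDiffOn 𝕜 ∞ ρ U → ∀ p ∈ U, A.bracket σ (τ + ρ) p = A.bracket σ τ p + A.bracket σ ρ p
  bracket_skew : ∀ σ τ : E → F, ContDiffOn 𝕜 ∞ σ U → ContDiffOn 𝕜 ∞ τ U →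
    ∀ p ∈ U, A.bracket σ τ p = -A.bracket τ σ p
  jacobi : ∀ σ τ ρ : E → F, ContDiffOn 𝕜 ∞ σ U → ContDiffOn 𝕜 ∞ τ U →
    ContDiffOn 𝕜 ∞ ρ U → ∀ p ∈ U,
      A.bracket σ (A.bracket τ ρ) p
        = A.bracket (A.bracket σ τ) ρ p + A.bracket τ (A.bracket σ ρ) p
  leibniz : ∀ (σ τ : E → F) (f : E → 𝕜), ContDiffOn 𝕜 ∞ σ U → ContDiffOn 𝕜 ∞ τ U →
    ContDiffOn 𝕜 ∞ f U → ∀ p ∈ U,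
      A.bracket σ (fun q => f q • τ q) p
        = f p • A.bracket σ τ p + (fderiv 𝕜 f p (A.anchor p (σ p))) • τ p
  /-- The anchor maps the bracket to the Lie bracket of vector fields. -/
  anchor_bracket : ∀ σ τ : E → F, ContDiffOn 𝕜 ∞ σ U → ContDiffOn 𝕜 ∞ τ U →
    ∀ p ∈ U, A.anchor p (A.bracket σ τ p) =
      VectorField.lieBracket 𝕜 (fun q => A.anchor q (σ q)) (fun q => A.anchor q (τ q)) p

/-- `T` is a morphism of Lie algebroids over the identity of `U`. -/
structure AlgebroidData.IsMorphism (A : AlgebroidData 𝕜 E F) (B : AlgebroidData 𝕜 E F')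
    (U : Set E) (T : E → F →L[𝕜] F') : Prop where
  smooth : ContDiffOn 𝕜 ∞ T U
  anchor : ∀ p ∈ U, ∀ v : F, B.anchor p (T p v) = A.anchor p v
  bracket : ∀ σ τ : E → F, ContDiffOn 𝕜 ∞ σ U → ContDiffOn 𝕜 ∞ τ U → ∀ p ∈ U,
    T p (A.bracket σ τ p) = B.bracket (fun q => T q (σ q)) (fun q => T q (τ q)) p

/-- `T` is an isomorphism of Lie algebroids over the identity of `U`. -/
def AlgebroidData.IsIsomorphism (A : AlgebroidData 𝕜 E F) (B : AlgebroidData 𝕜 E F')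
    (U : Set E) (T : E → F →L[𝕜] F') : Prop :=
  A.IsMorphism B U T ∧ ∃ S : E → F' →L[𝕜] F, B.IsMorphism A U S ∧
    ∀ p ∈ U, (∀ v, S p (T p v) = v) ∧ (∀ w, T p (S p w) = w)

/-- The trivial Lie algebroid `TU × 𝔨` with vertex algebra `𝔨` (a Lie algebra structure on `F`):
the anchor is the projection, and
`[(X, x), (X', x')] = ([X, X'], X · x' - X' · x + [x, x'])`. -/
def trivialAlgebroid (E : Type*) [NormedAddCommGroup E] [NormedSpace 𝕜 E]
    (𝔨 : LieStructure 𝕜 F) : AlgebroidData 𝕜 E (E × F) where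
  anchor _ := ContinuousLinearMap.fst 𝕜 E F
  bracket σ τ p :=
    (VectorField.lieBracket 𝕜 (fun q => (σ q).1) (fun q => (τ q).1) p,
      fderiv 𝕜 (fun q => (τ q).2) p (σ p).1 - fderiv 𝕜 (fun q => (σ q).2) p (τ p).1
        + 𝔨.bracket (σ p).2 (τ p).2)

end Algebroids

/-! ### Power series of an endomorphism -/

section Series

variable {𝕜 V : Type*} [RCLike 𝕜] [NormedAddCommGroup V] [NormedSpace 𝕜 V]

/-- `e^A = ∑ A^k / k!`. -/
def expSeriesSum (A : V →L[𝕜] V) : V →L[𝕜] V := ∑' k : ℕ, ((k.factorial : 𝕜)⁻¹) • A ^ k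

/-- `(e^A - 1) / A = ∑ A^k / (k+1)!`. -/
def expSubOneDiv (A : V →L[𝕜] V) : V →L[𝕜] V :=
  ∑' k : ℕ, (((k + 1).factorial : 𝕜)⁻¹) • A ^ k

/-- The identification of a finite-dimensional space with its bidual. -/
def bidualEquiv (𝕜 V : Type*) [RCLike 𝕜] [NormedAddCommGroup V] [NormedSpace 𝕜 V]
    [FiniteDimensional 𝕜 V] : V ≃ₗ[𝕜] StrongDual 𝕜 (StrongDual 𝕜 V) :=
  LinearMap.linearEquivOfInjective (K := 𝕜) (V := V) (V₂ := StrongDual 𝕜 (StrongDual 𝕜 V))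
    (NormedSpace.inclusionInDoubleDual 𝕜 V).toLinearMap
    (NormedSpace.inclusionInDoubleDualLi (𝕜 := 𝕜) (E := V)).injective <| by
    have h₁ : Module.finrank 𝕜 (StrongDual 𝕜 V) = Module.finrank 𝕜 V := by
      rw [← Subspace.dual_finrank_eq (K := 𝕜) (V := V)]
      exact (LinearMap.toContinuousLinearMap (𝕜 := 𝕜) (E := V) (F' := 𝕜)).symm.finrank_eq
    have h₂ : Module.finrank 𝕜 (StrongDual 𝕜 (StrongDual 𝕜 V)) =
        Module.finrank 𝕜 (StrongDual 𝕜 V) := by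
      rw [← Subspace.dual_finrank_eq (K := 𝕜) (V := StrongDual 𝕜 V)]
      exact (LinearMap.toContinuousLinearMap (𝕜 := 𝕜) (E := StrongDual 𝕜 V)
        (F' := 𝕜)).symm.finrank_eq
    exact (h₂.trans h₁).symm

theorem apply_bidualEquiv_symm [FiniteDimensional 𝕜 V] (Φ : StrongDual 𝕜 (StrongDual 𝕜 V))
    (β : StrongDual 𝕜 V) : β ((bidualEquiv 𝕜 V).symm Φ) = Φ β := by
  obtain ⟨v, rfl⟩ := (bidualEquiv 𝕜 V).surjective Φ
  rw [LinearEquiv.symm_apply_apply]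
  rfl

end Series

namespace LieQuasiBialgebra.ReductiveDecomposition

variable {𝕜 𝔤 : Type*} [RCLike 𝕜] [NormedAddCommGroup 𝔤] [NormedSpace 𝕜 𝔤]
  [FiniteDimensional 𝕜 𝔤] {Q : LieQuasiBialgebra 𝕜 𝔤}

/-- The Lie algebra structure of the subalgebra `L`. -/
def lieL (D : Q.ReductiveDecomposition) : LieStructure 𝕜 D.L :=
  Q.toLieStructure.restrict D.L D.bracket_mem_L

/-- The projection `p_L` of `𝔤` onto `L` along `M`. -/
def projL (D : Q.ReductiveDecomposition) : 𝔤 →L[𝕜] D.L :=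
  LinearMap.toContinuousLinearMap (D.L.projectionOnto D.M D.isCompl)

/-- `s : L* → 𝔤*`, the transpose of `p_L`. -/
def s (D : Q.ReductiveDecomposition) (α : StrongDual 𝕜 D.L) : StrongDual 𝕜 𝔤 :=
  α.comp D.projL

/-- `i^* : 𝔤* → L*`, restriction to `L`. -/
def iStar (D : Q.ReductiveDecomposition) (ξ : StrongDual 𝕜 𝔤) : StrongDual 𝕜 D.L :=
  ξ.comp D.L.subtypeL

/-- The subspace `𝔤^⋆_0 = L ⊕ L^⊥` of the double. -/
def gStarSubmodule (D : Q.ReductiveDecomposition) : Submodule 𝕜 (𝔤 × StrongDual 𝕜 𝔤) where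
  carrier := {X | X.1 ∈ D.L ∧ ∀ z ∈ D.L, X.2 z = 0}
  zero_mem' := ⟨D.L.zero_mem, fun _ _ => rfl⟩
  add_mem' := by
    rintro X Y ⟨h1, h2⟩ ⟨h3, h4⟩
    exact ⟨D.L.add_mem h1 h3, fun z hz => by simp [h2 z hz, h4 z hz]⟩
  smul_mem' := by
    rintro c X ⟨h1, h2⟩
    exact ⟨D.L.smul_mem c h1, fun z hz => by simp [h2 z hz]⟩

theorem bracket_mem_gStar (D : Q.ReductiveDecomposition) :
    ∀ X ∈ D.gStarSubmodule, ∀ Y ∈ D.gStarSubmodule, Q.double.bracket X Y ∈ D.gStarSubmodule := by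
  rintro ⟨z, ξ⟩ ⟨hz, hξ⟩ ⟨w, η⟩ ⟨hw, hη⟩
  have hcoe : ∀ z (hz : z ∈ D.L), (D.projL z : 𝔤) = z := by
    intro z hz
    have h := Submodule.projectionOnto_apply_left D.isCompl ⟨z, hz⟩
    exact congrArg Subtype.val h
  have hphi : Q.phi ξ η ∈ D.L := by
    have h : Q.phi ξ η = (D.projL (Q.phi ξ η) : 𝔤) := by
      apply (SeparatingDual.eq_iff_forall_dual_eq (R := 𝕜)).2
      intro θ
      have h0 := D.phi_mod_L ξ η (θ - θ.comp (D.L.subtypeL.comp D.projL)) hξ hη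
        (fun z hz => by simp [hcoe z hz])
      simpa [sub_eq_zero] using h0
    rw [h]
    exact (D.projL (Q.phi ξ η)).2
  change Q.doubleBracket _ _ ∈ _
  rw [doubleBracket_apply]
  refine ⟨?_, fun y hy => ?_⟩
  · simpa [D.varpi_L z hz, D.varpi_L w hw] using D.L.add_mem (D.bracket_mem_L z hz w hw) hphi
  · simp [D.varpi_L y hy, hη _ (D.bracket_mem_L z hz y hy), hξ _ (D.bracket_mem_L w hw y hy)]

/-- The Lie algebra `𝔤^⋆_0 = L ⊕ L^⊥`, a Lie subalgebra of the double. -/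
def gStar (D : Q.ReductiveDecomposition) : LieStructure 𝕜 D.gStarSubmodule :=
  Q.double.restrict D.gStarSubmodule D.bracket_mem_gStar

/-! ### Dynamical `ℓ`-matrices -/

/-- The equations of a classical dynamical `ℓ`-matrix at the point `p`: `l_p` is skew, and `l`
satisfies the generalized classical dynamical Yang--Baxter equation and the
`L`-(quasi-)equivariance equation at `p`. -/
structure IsDynamicalAt (D : Q.ReductiveDecomposition)
    (l : StrongDual 𝕜 D.L → StrongDual 𝕜 𝔤 →L[𝕜] 𝔤) (p : StrongDual 𝕜 D.L) : Prop where
  skew : ∀ ξ η : StrongDual 𝕜 𝔤, ξ (l p η) = -η (l p ξ)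
  yangBaxter : ∀ ξ η ζ : StrongDual 𝕜 𝔤,
    (ζ (fderiv 𝕜 l p (D.iStar ξ) η) - ζ (Q.bracket (l p ξ) (l p η)) - ζ (Q.varpi (l p ξ) η))
    + (ξ (fderiv 𝕜 l p (D.iStar η) ζ) - ξ (Q.bracket (l p η) (l p ζ)) - ξ (Q.varpi (l p η) ζ))
    + (η (fderiv 𝕜 l p (D.iStar ζ) ξ) - η (Q.bracket (l p ζ) (l p ξ)) - η (Q.varpi (l p ζ) ξ))
      = ζ (Q.phi ξ η)
  equivariance : ∀ (z : D.L) (ξ : StrongDual 𝕜 𝔤),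
    fderiv 𝕜 l p (D.lieL.adStar z p) ξ + Q.varpi z ξ + Q.bracket z (l p ξ) + l p (Q.adStar z ξ) = 0

/-- The germ of `l` at `0` is (the sum of) the canonical dynamical `ℓ`-matrix of `Q` and
`𝔤 = L ⊕ M`: the dynamical `ℓ`-matrix such that `l_0 = 0` and `l_p (s p) = 0`. -/
structure IsCanonical (D : Q.ReductiveDecomposition)
    (l : StrongDual 𝕜 D.L → StrongDual 𝕜 𝔤 →L[𝕜] 𝔤) : Prop where
  analyticAt : AnalyticAt 𝕜 l 0
  dynamical : ∀ᶠ p in 𝓝 0, D.IsDynamicalAt l p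
  zero : l 0 = 0
  apply_s : ∀ᶠ p in 𝓝 0, l p (D.s p) = 0

/-! ### The Lie algebroid `N(U)` and the bundle map `T` -/

/-- The functional `β ↦ ⟨ξ, d_p l(β) η⟩` on `L*`. -/
def derivPair (D : Q.ReductiveDecomposition)
    (l : StrongDual 𝕜 D.L → StrongDual 𝕜 𝔤 →L[𝕜] 𝔤) (p : StrongDual 𝕜 D.L)
    (ξ η : StrongDual 𝕜 𝔤) : StrongDual 𝕜 (StrongDual 𝕜 D.L) :=
  ξ.comp ((fderiv 𝕜 l p).flip η)

/-- The anchor of `N(U)`: `(z, ξ) ↦ i^* ξ - ad^*_z p`. -/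
def anchorN (D : Q.ReductiveDecomposition) (p : StrongDual 𝕜 D.L) :
    (D.L × StrongDual 𝕜 𝔤) →L[𝕜] StrongDual 𝕜 D.L :=
  LinearMap.toContinuousLinearMap
    { toFun := fun v => D.iStar v.2 - D.lieL.adStar v.1 p
      map_add' := by intro v w; ext; simp [iStar]; abel
      map_smul' := by intro c v; ext; simp [iStar, mul_sub] }

@[simp]
theorem anchorN_apply (D : Q.ReductiveDecomposition) (p : StrongDual 𝕜 D.L)
    (v : D.L × StrongDual 𝕜 𝔤) : D.anchorN p v = D.iStar v.2 - D.lieL.adStar v.1 p := rfl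

/-- The Lie algebroid `N(U) = U × L × 𝔤*` of the dual Poisson groupoid. -/
def algebroidN (D : Q.ReductiveDecomposition)
    (l : StrongDual 𝕜 D.L → StrongDual 𝕜 𝔤 →L[𝕜] 𝔤) :
    AlgebroidData 𝕜 (StrongDual 𝕜 D.L) (D.L × StrongDual 𝕜 𝔤) where
  anchor := D.anchorN
  bracket σ τ p :=
    (fderiv 𝕜 (fun q => (τ q).1) p (D.anchorN p (σ p))
        - fderiv 𝕜 (fun q => (σ q).1) p (D.anchorN p (τ p))
        - D.lieL.bracket (σ p).1 (τ p).1
        + (bidualEquiv 𝕜 D.L).symm (D.derivPair l p (σ p).2 (τ p).2),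
      fderiv 𝕜 (fun q => (τ q).2) p (D.anchorN p (σ p))
        - fderiv 𝕜 (fun q => (σ q).2) p (D.anchorN p (τ p))
        + Q.adStar (σ p).1 (τ p).2 - Q.adStar (τ p).1 (σ p).2
        + Q.coPair (σ p).2 (τ p).2
        + Q.adStar (l p (σ p).2) (τ p).2 - Q.adStar (l p (τ p).2) (σ p).2)

/-- `ad_{sp}`, acting on the double. -/
def adS (D : Q.ReductiveDecomposition) (p : StrongDual 𝕜 D.L) :
    (𝔤 × StrongDual 𝕜 𝔤) →L[𝕜] (𝔤 × StrongDual 𝕜 𝔤) :=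
  Q.double.bracket (0, D.s p)

/-- `Ad_{exp(sp)} = e^{ad_{sp}}`, acting on the double. -/
def AdExp (D : Q.ReductiveDecomposition) (p : StrongDual 𝕜 D.L) :
    (𝔤 × StrongDual 𝕜 𝔤) →L[𝕜] (𝔤 × StrongDual 𝕜 𝔤) :=
  expSeriesSum (D.adS p)

/-- `((Ad_{exp(sp)} - 1) / ad_{sp}) (s α)`. -/
def omega (D : Q.ReductiveDecomposition) (p α : StrongDual 𝕜 D.L) : 𝔤 × StrongDual 𝕜 𝔤 :=
  expSubOneDiv (D.adS p) (0, D.s α)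

theorem omega_add (D : Q.ReductiveDecomposition) (p α β : StrongDual 𝕜 D.L) :
    D.omega p (α + β) = D.omega p α + D.omega p β := by
  have h : ((0, D.s (α + β)) : 𝔤 × StrongDual 𝕜 𝔤) = (0, D.s α) + (0, D.s β) := by
    ext <;> simp [s]
  rw [omega, h, map_add]
  rfl

theorem omega_smul (D : Q.ReductiveDecomposition) (c : 𝕜) (p α : StrongDual 𝕜 D.L) :
    D.omega p (c • α) = c • D.omega p α := by
  have h : ((0, D.s (c • α)) : 𝔤 × StrongDual 𝕜 𝔤) = c • (0, D.s α) := by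
    ext <;> simp [s]
  rw [omega, h, map_smul]
  rfl

/-- `τ_t (x + ξ) = (x + t ξ) + ξ`. -/
def tau (t : StrongDual 𝕜 𝔤 →L[𝕜] 𝔤) (X : 𝔤 × StrongDual 𝕜 𝔤) : 𝔤 × StrongDual 𝕜 𝔤 :=
  (X.1 + t X.2, X.2)

/-- `u_p α = p_L τ_{-l_p} ((Ad_{exp(sp)} - 1) / ad_{sp}) (s α)`. -/
def u (D : Q.ReductiveDecomposition) (l : StrongDual 𝕜 D.L → StrongDual 𝕜 𝔤 →L[𝕜] 𝔤)
    (p α : StrongDual 𝕜 D.L) : D.L :=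
  D.projL (tau (-l p) (D.omega p α)).1

/-- The bundle map `T : U × L* × 𝔤^⋆_0 → U × L × 𝔤*`. -/
def T (D : Q.ReductiveDecomposition) (l : StrongDual 𝕜 D.L → StrongDual 𝕜 𝔤 →L[𝕜] 𝔤)
    (p : StrongDual 𝕜 D.L) :
    (StrongDual 𝕜 D.L × D.gStarSubmodule) →L[𝕜] (D.L × StrongDual 𝕜 𝔤) :=
  LinearMap.toContinuousLinearMap
    { toFun := fun v : StrongDual 𝕜 D.L × D.gStarSubmodule =>
        (D.u l p v.1 - D.projL (tau (-l p) (D.AdExp p v.2)).1,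
          (D.omega p v.1).2 - (D.AdExp p v.2).2)
      map_add' := by
        intro v w
        ext <;> simp [u, omega_add, tau] <;> abel
      map_smul' := by
        intro c v
        ext <;> simp [u, omega_smul, tau, smul_sub, smul_add] }

@[simp]
theorem T_apply (D : Q.ReductiveDecomposition) (l : StrongDual 𝕜 D.L → StrongDual 𝕜 𝔤 →L[𝕜] 𝔤)
    (p : StrongDual 𝕜 D.L) (v : StrongDual 𝕜 D.L × D.gStarSubmodule) :
    D.T l p v = (D.u l p v.1 - D.projL (tau (-l p) (D.AdExp p v.2)).1,
      (D.omega p v.1).2 - (D.AdExp p v.2).2) := rfl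

end LieQuasiBialgebra.ReductiveDecomposition

end

/-! Embed both algebroids into the trivial bundle with fibre the double. Let ι_p(z, ξ) = z + l_p ξ +
ξ, let Ad_p = e^{ad_{sp}}, and let ω_p α = ((Ad_p - 1)/ad_{sp}) s α, the logarithmic derivative of p
↦ Ad_p. The central claim (`iota_T`, `anchorN_T`) is that ι_p T_p(α, X) = ω_p α - Ad_p X and that
T_p carries the projection to L* to the anchor of N(U).

Both statements say that, for y = Ad X and for y = ω α, the vector (τ_{-l} y)_𝔤 stays in L and the
anchor of τ_{-l} y has a constant value. They follow from uniqueness for singular radial equations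
d_p f(p) + c f(p) = B(p) f(p) with f(0) = 0, B(0) = 0 and c a natural number. Indeed Ad X and ω α
solve radial equations with c = 0 and c = 1. The Yang–Baxter equation with first argument s p,
combined with l_p s p = 0, is a radial Riccati equation for l (`radial_ellMatrix`). Hence the
M-component of (τ_{-l} y)_𝔤 and the defect of the anchor together satisfy a closed homogeneous
linear radial system (`eq_zero_of_radial_double`).

For the brackets, the dynamical equations say exactly that ι carries the bracket of N(U) to
"derivative along the anchors minus bracket of the double" (`iota_bracket`). The gauge map (α, X) ↦
ω α - Ad X turns the bracket of the trivial algebroid into the same expression (`bracket_gauge`),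
because ω satisfies the Maurer–Cartan equation and Ad is an automorphism; these two facts come from
radial uniqueness as well. Since ι is injective, T preserves brackets.

If T_p(α, X) = 0, the anchor gives α = 0 and then Ad_p X = 0 gives X = 0; a dimension count makes
T_p bijective. The Jacobi identity of N(U) is never computed: all the axioms are transported through
T from the trivial algebroid. -/

noncomputable section

/-! ### Uniqueness for radial equations singular at the origin. -/

section RadialEquations

variable {𝕜 E W : Type*} [RCLike 𝕜] [NormedAddCommGroup E] [NormedSpace 𝕜 E]
  [NormedAddCommGroup W] [NormedSpace 𝕜 W]

/-- Uniqueness for singular radial equations `d_p f(p) + c f(p) = O(‖p‖ ‖f(p)‖)`, `f 0 = 0`. -/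
theorem eventually_eq_zero_of_norm_radial_le {f : E → W} (c : ℕ) (C : ℝ)
    (hf : ∀ᶠ p in 𝓝 0, DifferentiableAt 𝕜 f p) (h0 : f 0 = 0)
    (h : ∀ᶠ p in 𝓝 0, ‖fderiv 𝕜 f p p + (c : 𝕜) • f p‖ ≤ C * ‖p‖ * ‖f p‖) :
    ∀ᶠ p in 𝓝 0, f p = 0 := by
  -- Any constant below 1 would do: it becomes the contraction factor for the maximum of `‖g‖` on
  -- the ray.
  have hC : ∀ᶠ p : E in 𝓝 0, C * ‖p‖ < 1 / 2 := by
    have : Filter.Tendsto (fun p : E => C * ‖p‖) (𝓝 0) (𝓝 (C * ‖(0 : E)‖)) :=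
      (continuous_const.mul continuous_norm).tendsto 0
    exact this.eventually_lt_const (by simp)
  obtain ⟨ε, hε, hball⟩ := Metric.eventually_nhds_iff_ball.1 ((hf.and h).and hC)
  refine Metric.eventually_nhds_iff_ball.2 ⟨ε, hε, fun p hp => ?_⟩
  have hseg : ∀ t ∈ Set.Icc (0 : ℝ) 1, (t : 𝕜) • p ∈ Metric.ball (0 : E) ε := by
    intro t ht
    rw [mem_ball_zero_iff] at hp ⊢
    rw [norm_smul, RCLike.norm_ofReal, abs_of_nonneg ht.1]
    exact (mul_le_of_le_one_left (norm_nonneg _) ht.2).trans_lt hp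
  let _ : NormedSpace ℝ W := NormedSpace.restrictScalars ℝ 𝕜 W
  -- The integrating factor t^c absorbs the term c f. For c = 0 the truncated exponent c - 1 in `g'`
  -- is harmless, its coefficient being 0.
  let g : ℝ → W := fun t => ((t : 𝕜) ^ c) • f ((t : 𝕜) • p)
  let g' : ℝ → W := fun t => ((t : 𝕜) ^ c) • fderiv 𝕜 f ((t : 𝕜) • p) p
    + ((c : 𝕜) * (t : 𝕜) ^ (c - 1)) • f ((t : 𝕜) • p)
  have hder : ∀ t ∈ Set.Icc (0 : ℝ) 1, HasDerivAt g (g' t) t := by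
    intro t ht
    have h1 : HasDerivAt (fun x : 𝕜 => f (x • p)) (fderiv 𝕜 f ((t : 𝕜) • p) p) (t : 𝕜) := by
      have := (hball _ (hseg t ht)).1.1.hasFDerivAt.comp_hasDerivAt (t : 𝕜)
        ((hasDerivAt_id (t : 𝕜)).smul_const p)
      simpa [Function.comp_def] using this
    have h2 := ((hasDerivAt_pow c (t : 𝕜)).fun_smul h1).scomp_of_eq t
      (RCLike.ofRealCLM (K := 𝕜)).hasDerivAt rfl
    simpa [Function.comp_def] using h2
  have hbound : ∀ t ∈ Set.Ioc (0 : ℝ) 1, ‖g' t‖ ≤ 1 / 2 * ‖g t‖ := by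
    intro t ht
    have htc := Set.Ioc_subset_Icc_self ht
    have ht0 : (t : 𝕜) ≠ 0 := by exact_mod_cast ht.1.ne'
    -- Multiplying by t turns the direction p into the base point t p, where the hypothesis applies;
    -- ‖t p‖ then supplies a factor t, which cancels for t > 0.
    have e : (t : 𝕜) • g' t = ((t : 𝕜) ^ c) •
        (fderiv 𝕜 f ((t : 𝕜) • p) ((t : 𝕜) • p) + (c : 𝕜) • f ((t : 𝕜) • p)) := by
      simp only [g', map_smul, smul_add, smul_smul]
      congr 2
      · ring
      · rcases c with _ | c
        · simp
        · simp only [Nat.add_sub_cancel]; ring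
    have e2 := (hball _ (hseg t htc)).1.2
    have hnt : ‖(t : 𝕜)‖ = t := by rw [RCLike.norm_ofReal, abs_of_pos ht.1]
    have e3 : t * ‖g' t‖ ≤ t * (1 / 2 * ‖g t‖) := by
      calc t * ‖g' t‖ = ‖(t : 𝕜) • g' t‖ := by rw [norm_smul, hnt]
        _ = t ^ c * ‖fderiv 𝕜 f ((t : 𝕜) • p) ((t : 𝕜) • p) + (c : 𝕜) • f ((t : 𝕜) • p)‖ := by
          rw [e, norm_smul, norm_pow, hnt]
        _ ≤ t ^ c * (C * ‖(t : 𝕜) • p‖ * ‖f ((t : 𝕜) • p)‖) :=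
          mul_le_mul_of_nonneg_left e2 (pow_nonneg ht.1.le _)
        _ = t * (C * ‖p‖ * ‖g t‖) := by
          simp only [g, norm_smul, norm_pow, hnt]; ring
        _ ≤ t * (1 / 2 * ‖g t‖) := by
          have := (hball p hp).2.le
          have := ht.1.le
          gcongr
    exact le_of_mul_le_mul_left e3 ht.1
  have hg0 : g 0 = 0 := by simp [g, h0]
  have hcont : ContinuousOn g (Set.Icc 0 1) := fun t ht =>
    (hder t ht).continuousAt.continuousWithinAt
  -- At a maximum m of ‖g‖, the mean value inequality on [δ, m] with δ → 0 bounds ‖g m‖ by half of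
  -- itself. The interval starts at δ > 0 because `hbound` excludes t = 0.
  obtain ⟨m, hm, hmax⟩ := isCompact_Icc.exists_isMaxOn (Set.nonempty_Icc.2 zero_le_one)
    hcont.norm
  have key : ‖g m‖ ≤ 1 / 2 * ‖g m‖ := by
    rcases hm.1.eq_or_lt with rfl | hmpos
    · simp [hg0]
    have h1 : ∀ δ ∈ Set.Ioc 0 m, ‖g m - g δ‖ ≤ 1 / 2 * ‖g m‖ := by
      intro δ hδ
      have hsub : ∀ t ∈ Set.Icc δ m, t ∈ Set.Ioc (0 : ℝ) 1 := fun t ht =>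
        ⟨hδ.1.trans_le ht.1, ht.2.trans hm.2⟩
      have := (convex_Icc δ m).norm_image_sub_le_of_norm_hasDerivWithin_le (f := g) (f' := g')
        (C := 1 / 2 * ‖g m‖)
        (fun t ht => (hder t (Set.Ioc_subset_Icc_self (hsub t ht))).hasDerivWithinAt)
        (fun t ht => (hbound t (hsub t ht)).trans
          (mul_le_mul_of_nonneg_left (hmax (Set.Ioc_subset_Icc_self (hsub t ht))) (by norm_num)))
        (Set.left_mem_Icc.2 hδ.2) (Set.right_mem_Icc.2 hδ.2)
      refine this.trans (mul_le_of_le_one_right (by positivity) ?_)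
      rw [Real.norm_eq_abs, abs_of_nonneg (sub_nonneg.2 hδ.2)]
      linarith [hδ.1, hm.2]
    have h2 : Filter.Tendsto (fun δ => ‖g m - g δ‖) (𝓝[>] 0) (𝓝 ‖g m - g 0‖) :=
      ((hder 0 (by simp)).continuousAt.tendsto.mono_left nhdsWithin_le_nhds).const_sub _ |>.norm
    have h3 := le_of_tendsto h2 (Filter.eventually_of_mem (Ioc_mem_nhdsGT hmpos) h1)
    simpa [hg0] using h3
  have hgm : ‖g m‖ ≤ 0 := by linarith
  have h1 : ‖g 1‖ ≤ 0 := (hmax (Set.right_mem_Icc.2 zero_le_one)).trans hgm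
  simpa [g] using h1

theorem exists_norm_le_of_differentiableAt {B : E → W →L[𝕜] W} (hB : DifferentiableAt 𝕜 B 0)
    (hB0 : B 0 = 0) : ∃ C : ℝ, ∀ᶠ p in 𝓝 0, ∀ w, ‖B p w‖ ≤ C * ‖p‖ * ‖w‖ := by
  obtain ⟨C, hC⟩ := hB.isBigO_sub.bound
  refine ⟨C, hC.mono fun p hp w => ((B p).le_opNorm w).trans ?_⟩
  have : ‖B p‖ ≤ C * ‖p‖ := by simpa [hB0] using hp
  gcongr

/-- Uniqueness for linear singular radial equations `d_p f(p) + c f(p) = B(p) f(p)`, `f 0 = 0`,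
where `B 0 = 0`. -/
theorem AnalyticOnNhd.eq_zero_of_radial {U : Set E} (hU : IsPreconnected U) (hU0 : U ∈ 𝓝 0)
    {f : E → W} (hf : AnalyticOnNhd 𝕜 f U) (h0 : f 0 = 0) (c : ℕ)
    {B : E → W →L[𝕜] W} (hB : DifferentiableAt 𝕜 B 0) (hB0 : B 0 = 0)
    (h : ∀ᶠ p in 𝓝 0, fderiv 𝕜 f p p + (c : 𝕜) • f p = B p (f p)) :
    ∀ p ∈ U, f p = 0 := by
  obtain ⟨C, hC⟩ := exists_norm_le_of_differentiableAt hB hB0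
  refine hf.eqOn_zero_of_preconnected_of_eventuallyEq_zero hU (mem_of_mem_nhds hU0) ?_
  have hdiff : ∀ᶠ p in 𝓝 0, DifferentiableAt 𝕜 f p :=
    Filter.eventually_of_mem hU0 fun p hp => (hf p hp).differentiableAt
  filter_upwards [eventually_eq_zero_of_norm_radial_le c C hdiff h0
    (by filter_upwards [h, hC] with p hp hCp; rw [hp]; exact hCp _)] with p hp using hp

end RadialEquations

/-! ### The entire functions e^A and (e^A - 1)/A of an endomorphism. -/

section Series

variable {𝕜 V : Type*} [RCLike 𝕜] [NormedAddCommGroup V] [NormedSpace 𝕜 V]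

/-- The exponent 0 is separate because V may be trivial, and then ‖1‖ = 0. -/
theorem ContinuousLinearMap.norm_pow_le_pow_norm (A : V →L[𝕜] V) (k : ℕ) : ‖A ^ k‖ ≤ ‖A‖ ^ k := by
  rcases k.eq_zero_or_pos with rfl | hk
  · rw [pow_zero, pow_zero]
    exact ContinuousLinearMap.norm_id_le
  · exact norm_pow_le' A hk

theorem expSeriesSum_eq_exp (A : V →L[𝕜] V) : expSeriesSum A = NormedSpace.exp A := by
  rw [NormedSpace.exp_eq_tsum 𝕜]; rfl

theorem expSubOneDiv_zero : expSubOneDiv (0 : V →L[𝕜] V) = 1 := by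
  rw [expSubOneDiv, tsum_eq_single 0 (by intro k hk; simp [hk])]
  simp

variable [CompleteSpace V]

theorem summable_expSubOneDiv (A : V →L[𝕜] V) :
    Summable fun k : ℕ => (((k + 1).factorial : 𝕜)⁻¹) • A ^ k := by
  refine Summable.of_norm_bounded (Real.summable_pow_div_factorial ‖A‖) fun k => ?_
  rw [norm_smul, norm_inv, RCLike.norm_natCast, div_eq_inv_mul]
  gcongr
  · exact_mod_cast Nat.le_succ k
  · exact A.norm_pow_le_pow_norm k

/-- The ratio of consecutive coefficients is 1/(k + 2), so the power series has infinite radius of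
convergence. -/
theorem analyticAt_expSubOneDiv (A : V →L[𝕜] V) :
    AnalyticAt 𝕜 (expSubOneDiv (𝕜 := 𝕜) (V := V)) A := by
  let c : ℕ → 𝕜 := fun k => ((k + 1).factorial : 𝕜)⁻¹
  have hr : (FormalMultilinearSeries.ofScalars (V →L[𝕜] V) c).radius = ⊤ := by
    refine FormalMultilinearSeries.ofScalars_radius_eq_top_of_tendsto _ _
      (Filter.Eventually.of_forall fun n => by simp [c, Nat.factorial_ne_zero]) ?_
    have : (fun n : ℕ => ‖c n.succ‖ / ‖c n‖) = fun n : ℕ => 1 / ((n : ℝ) + 1 + 1) := by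
      ext n
      simp only [c, norm_inv, RCLike.norm_natCast, Nat.succ_eq_add_one]
      rw [Nat.factorial_succ (n + 1)]
      have : ((n + 1).factorial : ℝ) ≠ 0 := by exact_mod_cast Nat.factorial_ne_zero _
      push_cast
      field_simp
    rw [this]
    exact (Filter.tendsto_add_atTop_iff_nat 1).2 tendsto_one_div_add_atTop_nhds_zero_nat |>.congr
      fun n => by simp
  have h := (FormalMultilinearSeries.ofScalars (V →L[𝕜] V) c).hasFPowerSeriesOnBall
    (by rw [hr]; exact ENNReal.zero_lt_top)
  have e : (FormalMultilinearSeries.ofScalars (V →L[𝕜] V) c).sum = expSubOneDiv := by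
    ext1 A
    exact FormalMultilinearSeries.ofScalars_sum_eq c A
  rw [e] at h
  exact h.analyticAt_of_mem (by rw [hr]; exact edist_lt_top _ _)

theorem expSeriesSum_eq_one_add (A : V →L[𝕜] V) :
    expSeriesSum A = 1 + A * expSubOneDiv A := by
  have h : Summable fun k : ℕ => ((k.factorial : 𝕜)⁻¹) • A ^ k := by
    refine (summable_nat_add_iff 1).1 ?_
    simpa [pow_succ'] using (summable_expSubOneDiv A).mul_left A
  rw [expSeriesSum, h.tsum_eq_zero_add, expSubOneDiv, ← (summable_expSubOneDiv A).tsum_mul_left]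
  simp [pow_succ']

/-- The function is the sum of t^{k+1} A^k / (k+1)!, whose termwise derivative is the exponential
series. -/
theorem hasDerivAt_smul_expSubOneDiv (A : V →L[𝕜] V) :
    HasDerivAt (fun t : 𝕜 => t • expSubOneDiv (t • A)) (expSeriesSum A) 1 := by
  have hterm : ∀ (k : ℕ) (t : 𝕜), HasDerivAt
      (fun t : 𝕜 => (((k + 1).factorial : 𝕜)⁻¹ * t ^ (k + 1)) • A ^ k)
      (((k.factorial : 𝕜)⁻¹ * t ^ k) • A ^ k) t := by
    intro k t
    have h := ((hasDerivAt_pow (k + 1) t).const_mul ((k + 1).factorial : 𝕜)⁻¹).smul_const (A ^ k)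
    refine h.congr_deriv ?_
    congr 1
    have h1 : (k.factorial : 𝕜) ≠ 0 := by exact_mod_cast Nat.factorial_ne_zero k
    have h2 : ((k : 𝕜) + 1) ≠ 0 := by exact_mod_cast Nat.succ_ne_zero k
    rw [Nat.factorial_succ, Nat.add_sub_cancel]
    push_cast
    field_simp
  -- The ball of radius 2 contains both 0, where the series trivially converges, and 1; on it the
  -- derivatives are dominated by (2‖A‖)^k / k!.
  have h := hasDerivAt_tsum_of_isPreconnected (y := (1 : 𝕜)) (y₀ := 0)
    (Real.summable_pow_div_factorial (2 * ‖A‖)) (Metric.isOpen_ball (x := (0 : 𝕜)) (ε := 2))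
    (convex_ball (0 : 𝕜) 2).isPreconnected
    (fun k t _ => hterm k t) (fun k t ht => ?_) (by simp) (by simp [summable_zero]) (by simp)
  · simp only [one_pow, mul_one] at h
    refine h.congr_of_eventuallyEq (Filter.Eventually.of_forall fun t => ?_)
    simp only
    rw [expSubOneDiv, ← tsum_const_smul'']
    refine tsum_congr fun k => ?_
    rw [smul_pow, smul_smul, smul_smul]
    congr 1
    ring
  · have ht' : ‖t‖ ≤ 2 := (mem_ball_zero_iff.1 ht).le
    rw [norm_smul, norm_mul, norm_inv, RCLike.norm_natCast, norm_pow, div_eq_inv_mul, mul_pow,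
      mul_assoc]
    gcongr
    exact A.norm_pow_le_pow_norm k

/-- Compare the product rule for t • Φ(tA) at t = 1 with the derivative of its series. Only this
derivative, in the direction A itself, is needed, so noncommuting directions never have to be
handled in the series. -/
theorem fderiv_expSubOneDiv_self (A : V →L[𝕜] V) :
    fderiv 𝕜 (expSubOneDiv (𝕜 := 𝕜) (V := V)) A A = expSeriesSum A - expSubOneDiv A := by
  have h1 : HasDerivAt (fun t : 𝕜 => expSubOneDiv (t • A))
      (fderiv 𝕜 (expSubOneDiv (𝕜 := 𝕜) (V := V)) A A) 1 := by
    have h := (analyticAt_expSubOneDiv A).differentiableAt.hasFDerivAt.comp_hasDerivAt_of_eq (1 : 𝕜)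
      ((hasDerivAt_id (1 : 𝕜)).smul_const A) (by simp)
    simpa [Function.comp_def] using h
  have h2 := ((hasDerivAt_id (1 : 𝕜)).fun_smul h1).unique (hasDerivAt_smul_expSubOneDiv A)
  rw [← h2]
  simp

theorem eq_zero_of_expSeriesSum_apply_eq_zero (A : V →L[𝕜] V) {v : V}
    (h : expSeriesSum A v = 0) : v = 0 := by
  let _ : NormedAlgebra ℚ (V →L[𝕜] V) := NormedAlgebra.restrictScalars ℚ 𝕜 _
  obtain ⟨e, he⟩ : IsUnit (expSeriesSum A) := by
    rw [expSeriesSum_eq_exp]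
    exact NormedSpace.isUnit_exp A
  rw [← he] at h
  have h2 : (e⁻¹.1 * e.1) v = 0 := (congrArg e⁻¹.1 h).trans (map_zero _)
  simpa using h2

end Series

/-! ### The trivial Lie algebroid and transport of structure. -/

section Algebroids

variable {𝕜 E F F' : Type*} [RCLike 𝕜] [NormedAddCommGroup E] [NormedSpace 𝕜 E]
  [NormedAddCommGroup F] [NormedSpace 𝕜 F] [NormedAddCommGroup F'] [NormedSpace 𝕜 F']

theorem ContDiffOn.fderiv_apply_of_isOpen {U : Set E} (hU : IsOpen U) {f : E → F} {X : E → E}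
    (hf : ContDiffOn 𝕜 ∞ f U) (hX : ContDiffOn 𝕜 ∞ X U) :
    ContDiffOn 𝕜 ∞ (fun p => fderiv 𝕜 f p (X p)) U :=
  (hf.fderiv_of_isOpen hU (by simp)).clm_apply hX

theorem ContDiffOn.differentiableAt_of_isOpen {U : Set E} (hU : IsOpen U) {f : E → F}
    (hf : ContDiffOn 𝕜 ∞ f U) {p : E} (hp : p ∈ U) : DifferentiableAt 𝕜 f p :=
  (hf.contDiffAt (hU.mem_nhds hp)).differentiableAt (by simp)

theorem fderiv_congr_of_isOpen {U : Set E} (hU : IsOpen U) {f g : E → F} (h : Set.EqOn f g U)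
    {p : E} (hp : p ∈ U) : fderiv 𝕜 f p = fderiv 𝕜 g p :=
  (h.eventuallyEq_of_mem (hU.mem_nhds hp)).fderiv_eq

theorem lieBracket_congr_of_isOpen {U : Set E} (hU : IsOpen U) {V V' W W' : E → E}
    (hV : Set.EqOn V V' U) (hW : Set.EqOn W W' U) {p : E} (hp : p ∈ U) :
    VectorField.lieBracket 𝕜 V W p = VectorField.lieBracket 𝕜 V' W' p :=
  (hV.eventuallyEq_of_mem (hU.mem_nhds hp)).lieBracket_vectorField_eq
    (hW.eventuallyEq_of_mem (hU.mem_nhds hp))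

theorem trivialAlgebroid_isLieAlgebroid {U : Set E} (hU : IsOpen U) (𝔨 : LieStructure 𝕜 F) :
    (trivialAlgebroid E 𝔨).IsLieAlgebroid U := by
  constructor
  · exact contDiffOn_const
  · intro σ τ hσ hτ
    refine ContDiffOn.prodMk ?_ ?_
    · exact (hτ.fst.fderiv_apply_of_isOpen hU hσ.fst).sub
        (hσ.fst.fderiv_apply_of_isOpen hU hτ.fst)
    · exact ((hτ.snd.fderiv_apply_of_isOpen hU hσ.fst).sub
        (hσ.snd.fderiv_apply_of_isOpen hU hτ.fst)).add
          ((𝔨.bracket.contDiff.comp_contDiffOn hσ.snd).clm_apply hτ.snd)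
  · intro σ σ' τ τ' hσ hτ p hp
    have h1 : ∀ {σ σ' : E → E × F}, Set.EqOn σ σ' U →
        Set.EqOn (fun q => (σ q).1) (fun q => (σ' q).1) U := fun h q hq =>
      congrArg Prod.fst (h hq)
    have h2 : ∀ {σ σ' : E → E × F}, Set.EqOn σ σ' U →
        Set.EqOn (fun q => (σ q).2) (fun q => (σ' q).2) U := fun h q hq =>
      congrArg Prod.snd (h hq)
    simp only [trivialAlgebroid]
    rw [lieBracket_congr_of_isOpen hU (h1 hσ) (h1 hτ) hp, fderiv_congr_of_isOpen hU (h2 hσ) hp,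
      fderiv_congr_of_isOpen hU (h2 hτ) hp, hσ hp, hτ hp]
  · intro σ τ ρ hσ hτ hρ p hp
    have e1 := fderiv_fun_add (hτ.fst.differentiableAt_of_isOpen hU hp) (hρ.fst.differentiableAt_of_isOpen hU hp)
    have e2 := fderiv_fun_add (hτ.snd.differentiableAt_of_isOpen hU hp) (hρ.snd.differentiableAt_of_isOpen hU hp)
    ext1
    · simp only [trivialAlgebroid, VectorField.lieBracket, Pi.add_apply, Prod.fst_add, e1, map_add,
        add_apply]
      abel
    · simp only [trivialAlgebroid, Pi.add_apply, Prod.snd_add, Prod.fst_add, e2, map_add,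
        add_apply]
      abel
  · intro σ τ hσ hτ p hp
    ext1
    · simp only [trivialAlgebroid, Prod.fst_neg]
      exact VectorField.lieBracket_swap
    · simp only [trivialAlgebroid, Prod.snd_neg]
      rw [𝔨.bracket_skew (σ p).2]
      abel
  · intro σ τ ρ hσ hτ hρ p hp
    have hn : minSmoothness 𝕜 2 ≤ (∞ : WithTop ℕ∞) := by
      rw [minSmoothness_of_isRCLikeNormedField]
      exact WithTop.coe_le_coe.2 le_top
    ext1
    · exact VectorField.leibniz_identity_lieBracket hn (hσ.fst.contDiffAt (hU.mem_nhds hp)) (hτ.fst.contDiffAt (hU.mem_nhds hp)) (hρ.fst.contDiffAt (hU.mem_nhds hp))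
    -- Derivative of the 𝔨-component of an inner bracket, needed for each of the three terms of the
    -- Jacobi identity.
    · have key : ∀ {σ τ ρ : E → E × F}, ContDiffOn 𝕜 ∞ σ U → ContDiffOn 𝕜 ∞ τ U →
          ContDiffOn 𝕜 ∞ ρ U →
          fderiv 𝕜 (fun q => ((trivialAlgebroid E 𝔨).bracket τ ρ q).2) p (σ p).1 =
          fderiv 𝕜 (fun q => fderiv 𝕜 (fun q => (ρ q).2) q (τ q).1) p (σ p).1
          - fderiv 𝕜 (fun q => fderiv 𝕜 (fun q => (τ q).2) q (ρ q).1) p (σ p).1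
          + (𝔨.bracket (fderiv 𝕜 (fun q => (τ q).2) p (σ p).1) (ρ p).2
            + 𝔨.bracket (τ p).2 (fderiv 𝕜 (fun q => (ρ q).2) p (σ p).1)) := by
        intro σ τ ρ hσ hτ hρ
        have h1 := (hρ.snd.fderiv_apply_of_isOpen hU hτ.fst).differentiableAt_of_isOpen hU hp
        have h2 := (hτ.snd.fderiv_apply_of_isOpen hU hρ.fst).differentiableAt_of_isOpen hU hp
        have h3 := 𝔨.bracket.hasFDerivAt_of_bilinear (hτ.snd.differentiableAt_of_isOpen hU hp).hasFDerivAt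
          (hρ.snd.differentiableAt_of_isOpen hU hp).hasFDerivAt
        have h4 := (h1.hasFDerivAt.fun_sub h2.hasFDerivAt).fun_add h3
        simp only [trivialAlgebroid]
        rw [h4.fderiv]
        simp [add_comm]
      -- By symmetry of second derivatives, commutators of iterated derivatives are derivatives
      -- along Lie brackets. What remains is the Jacobi identity of 𝔨.
      have e1 := VectorField.fderiv_apply_lieBracket (hρ.snd.contDiffAt (hU.mem_nhds hp)) hn (hτ.fst.differentiableAt_of_isOpen hU hp) (hσ.fst.differentiableAt_of_isOpen hU hp)
      have e2 := VectorField.fderiv_apply_lieBracket (hτ.snd.contDiffAt (hU.mem_nhds hp)) hn (hρ.fst.differentiableAt_of_isOpen hU hp) (hσ.fst.differentiableAt_of_isOpen hU hp)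
      have e3 := VectorField.fderiv_apply_lieBracket (hσ.snd.contDiffAt (hU.mem_nhds hp)) hn (hρ.fst.differentiableAt_of_isOpen hU hp) (hτ.fst.differentiableAt_of_isOpen hU hp)
      have hdef : ∀ σ τ : E → E × F, (trivialAlgebroid E 𝔨).bracket σ τ p =
          (VectorField.lieBracket 𝕜 (fun q => (σ q).1) (fun q => (τ q).1) p,
            fderiv 𝕜 (fun q => (τ q).2) p (σ p).1 - fderiv 𝕜 (fun q => (σ q).2) p (τ p).1
              + 𝔨.bracket (σ p).2 (τ p).2) := fun _ _ => rfl
      rw [hdef σ ((trivialAlgebroid E 𝔨).bracket τ ρ), hdef ((trivialAlgebroid E 𝔨).bracket σ τ) ρ,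
        hdef τ ((trivialAlgebroid E 𝔨).bracket σ ρ)]
      simp only [Prod.snd_add, key hσ hτ hρ, key hτ hσ hρ, key hρ hσ hτ]
      simp only [hdef, e1, e2, e3, map_add, map_sub, add_apply, sub_apply]
      rw [𝔨.jacobi (σ p).2, 𝔨.bracket_skew (σ p).2 (fderiv 𝕜 (fun q => (τ q).2) p (ρ p).1),
        𝔨.bracket_skew (τ p).2 (fderiv 𝕜 (fun q => (σ q).2) p (ρ p).1)]
      abel
  · intro σ τ f hσ hτ hf p hp
    have e2 := fderiv_fun_smul (hf.differentiableAt_of_isOpen hU hp) (hτ.snd.differentiableAt_of_isOpen hU hp)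
    have e1 := fderiv_fun_smul (hf.differentiableAt_of_isOpen hU hp) (hτ.fst.differentiableAt_of_isOpen hU hp)
    ext1
    · simp only [trivialAlgebroid, VectorField.lieBracket, Prod.smul_fst, Prod.fst_add, e1]
      simp [smul_sub]
      abel
    · simp only [trivialAlgebroid, Prod.smul_snd, Prod.snd_add, Prod.smul_fst, e2]
      simp [smul_sub]
      abel
  · intro σ τ hσ hτ p hp
    rfl

/-- A vector bundle isomorphism that is a morphism from a Lie algebroid to an anchored bundle with
a (local) bracket is an isomorphism of Lie algebroids. -/
theorem AlgebroidData.IsMorphism.isIsomorphism_of_bijective [FiniteDimensional 𝕜 F]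
    [FiniteDimensional 𝕜 F'] {U : Set E} (hU : IsOpen U) {A : AlgebroidData 𝕜 E F}
    {B : AlgebroidData 𝕜 E F'} {T : E → F →L[𝕜] F'} (hA : A.IsLieAlgebroid U)
    (hT : A.IsMorphism B U T) (hbij : ∀ p ∈ U, Function.Bijective (T p))
    (hB : ∀ σ σ' τ τ' : E → F', Set.EqOn σ σ' U → Set.EqOn τ τ' U →
      Set.EqOn (B.bracket σ τ) (B.bracket σ' τ') U) :
    B.IsLieAlgebroid U ∧ A.IsIsomorphism B U T := by
  have : CompleteSpace F := FiniteDimensional.complete 𝕜 F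
  let S : E → F' →L[𝕜] F := fun p => (T p).inverse
  have hinv : ∀ p ∈ U, ∃ e : F ≃L[𝕜] F', (e : F →L[𝕜] F') = T p := fun p hp =>
    ⟨(LinearEquiv.ofBijective (T p : F →ₗ[𝕜] F') (hbij p hp)).toContinuousLinearEquiv, by
      ext; rfl⟩
  -- Inversion of continuous linear maps is smooth at every invertible one.
  have hS : ContDiffOn 𝕜 ∞ S U := by
    intro p hp
    obtain ⟨e, he⟩ := hinv p hp
    have h := contDiffAt_map_inverse (𝕜 := 𝕜) (n := ∞) e
    rw [he] at h
    exact h.comp_contDiffWithinAt p (hT.smooth p hp)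
  have hST : ∀ p ∈ U, ∀ v, S p (T p v) = v := by
    intro p hp v
    obtain ⟨e, he⟩ := hinv p hp
    simp [S, ← he]
  have hTS : ∀ p ∈ U, ∀ w, T p (S p w) = w := by
    intro p hp v
    obtain ⟨e, he⟩ := hinv p hp
    simp [S, ← he]
  let R : (E → F') → E → F := fun σ q => S q (σ q)
  have hR : ∀ {σ : E → F'}, ContDiffOn 𝕜 ∞ σ U → ContDiffOn 𝕜 ∞ (R σ) U := fun hσ =>
    hS.clm_apply hσ
  have hTR : ∀ σ : E → F', Set.EqOn (fun q => T q (R σ q)) σ U := fun σ q hq => hTS q hq _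
  -- On U the bracket of B is that of A conjugated by T; each bracket axiom for B is read off from
  -- this. Locality of B is needed since T ∘ S is known to be the identity only over U.
  have hbr : ∀ {σ τ : E → F'}, ContDiffOn 𝕜 ∞ σ U → ContDiffOn 𝕜 ∞ τ U →
      ∀ p ∈ U, B.bracket σ τ p = T p (A.bracket (R σ) (R τ) p) := by
    intro σ τ hσ hτ p hp
    rw [hT.bracket _ _ (hR hσ) (hR hτ) p hp]
    exact (hB _ _ _ _ (hTR σ) (hTR τ) hp).symm
  have hRbr : ∀ {σ τ : E → F'}, ContDiffOn 𝕜 ∞ σ U → ContDiffOn 𝕜 ∞ τ U →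
      Set.EqOn (R (B.bracket σ τ)) (A.bracket (R σ) (R τ)) U := by
    intro σ τ hσ hτ p hp
    simp only [R]
    rw [hbr hσ hτ p hp, hST p hp]
  have hanc : ∀ p ∈ U, ∀ w, B.anchor p w = A.anchor p (S p w) := by
    intro p hp w
    rw [← hT.anchor p hp, hTS p hp]
  have hsm : ∀ σ τ : E → F', ContDiffOn 𝕜 ∞ σ U → ContDiffOn 𝕜 ∞ τ U →
      ContDiffOn 𝕜 ∞ (B.bracket σ τ) U := fun σ τ hσ hτ =>
    (hT.smooth.clm_apply (hA.bracket_smooth _ _ (hR hσ) (hR hτ))).congr (hbr hσ hτ)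
  refine ⟨⟨?_, hsm, hB, ?_, ?_, ?_, ?_, ?_⟩, hT, S, ⟨hS, ?_, ?_⟩, fun p hp => ⟨hST p hp, hTS p hp⟩⟩
  · refine (hA.anchor_smooth.clm_comp hS).congr fun p hp => ?_
    ext1 w
    exact hanc p hp w
  · intro σ τ ρ hσ hτ hρ p hp
    rw [hbr hσ (τ := τ + ρ) (hτ.add hρ) p hp, hbr hσ hτ p hp, hbr hσ hρ p hp, ← map_add,
      ← hA.bracket_add _ _ _ (hR hσ) (hR hτ) (hR hρ) p hp]
    congr 2
    ext1 q
    simp [R]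
  · intro σ τ hσ hτ p hp
    rw [hbr hσ hτ p hp, hbr hτ hσ p hp, hA.bracket_skew _ _ (hR hσ) (hR hτ) p hp, map_neg]
  · intro σ τ ρ hσ hτ hρ p hp
    have hrefl : ∀ σ : E → F, Set.EqOn σ σ U := fun σ => Set.eqOn_refl σ U
    rw [hbr hσ (hsm τ ρ hτ hρ) p hp, hbr (hsm σ τ hσ hτ) hρ p hp, hbr hτ (hsm σ ρ hσ hρ) p hp,
      hA.bracket_congr _ _ _ _ (hrefl _) (hRbr hτ hρ) hp,
      hA.bracket_congr _ _ _ _ (hRbr hσ hτ) (hrefl _) hp,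
      hA.bracket_congr _ _ _ _ (hrefl _) (hRbr hσ hρ) hp, ← map_add,
      hA.jacobi _ _ _ (hR hσ) (hR hτ) (hR hρ) p hp]
  · intro σ τ f hσ hτ hf p hp
    have e : R (fun q => f q • τ q) = fun q => f q • R τ q := by
      ext1 q
      simp [R]
    rw [hbr hσ (τ := fun q => f q • τ q) (hf.smul hτ) p hp, hbr hσ hτ p hp, e, hA.leibniz _ _ _ (hR hσ) (hR hτ) hf p hp,
      map_add, map_smul, map_smul, hanc p hp]
    congr 2
    exact hTS p hp _
  · intro σ τ hσ hτ p hp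
    rw [hbr hσ hτ p hp, hT.anchor p hp, hA.anchor_bracket _ _ (hR hσ) (hR hτ) p hp]
    exact lieBracket_congr_of_isOpen hU (fun q hq => (hanc q hq _).symm)
      (fun q hq => (hanc q hq _).symm) hp
  · exact fun p hp v => (hanc p hp v).symm
  · exact fun σ τ hσ hτ p hp => hRbr hσ hτ hp

end Algebroids

theorem AlgebroidData.IsMorphism.of_contDiffOn_apply {𝕜 E F F' : Type*} [RCLike 𝕜]
    [NormedAddCommGroup E] [NormedSpace 𝕜 E] [NormedAddCommGroup F] [NormedSpace 𝕜 F]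
    [NormedAddCommGroup F'] [NormedSpace 𝕜 F'] [FiniteDimensional 𝕜 F] {A : AlgebroidData 𝕜 E F}
    {B : AlgebroidData 𝕜 E F'} {U : Set E} {T : E → F →L[𝕜] F'}
    (smooth : ∀ v, ContDiffOn 𝕜 ∞ (fun q => T q v) U)
    (anchor : ∀ p ∈ U, ∀ v : F, B.anchor p (T p v) = A.anchor p v)
    (bracket : ∀ σ τ : E → F, ContDiffOn 𝕜 ∞ σ U → ContDiffOn 𝕜 ∞ τ U → ∀ p ∈ U,
      T p (A.bracket σ τ p) = B.bracket (fun q => T q (σ q)) (fun q => T q (τ q)) p) :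
    A.IsMorphism B U T :=
  ⟨contDiffOn_clm_apply.2 smooth, anchor, bracket⟩

/-! ### The flat connection defined by the exponential of a linear family of derivations -/

section ExponentialFamily

variable {𝕜 E V W : Type*} [RCLike 𝕜] [NormedAddCommGroup E] [NormedSpace 𝕜 E]
  [NormedAddCommGroup V] [NormedSpace 𝕜 V]
  [NormedAddCommGroup W] [NormedSpace 𝕜 W]

theorem AnalyticAt.clm_apply {f : E → V →L[𝕜] W} {g : E → V} {p : E} (hf : AnalyticAt 𝕜 f p)
    (hg : AnalyticAt 𝕜 g p) : AnalyticAt 𝕜 (fun q => f q (g q)) p :=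
  ((ContinuousLinearMap.id 𝕜 (V →L[𝕜] W)).analyticAt_bilinear (f p, g p)).comp
    (f := fun q => (f q, g q)) (hf.prod hg)

/-- Symmetry of the second derivative. Consequently, differentiating a radial equation in a constant
direction raises its constant c by one. -/
theorem fderiv_radial_fderiv [CompleteSpace V] {f : E → V} {p : E} (hf : AnalyticAt 𝕜 f p) (β : E) :
    fderiv 𝕜 (fun q => fderiv 𝕜 f q β) p p + fderiv 𝕜 f p β =
      fderiv 𝕜 (fun q => fderiv 𝕜 f q q) p β := by
  have h := hf.fderiv.differentiableAt.hasFDerivAt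
  have hs : IsSymmSndFDerivAt 𝕜 f p := hf.contDiffAt.isSymmSndFDerivAt (n := ∞) (by
    rw [minSmoothness_of_isRCLikeNormedField]
    exact WithTop.coe_le_coe.2 le_top)
  rw [(h.clm_apply (hasFDerivAt_const β p)).fderiv, HasFDerivAt.fderiv (f := fun q => fderiv 𝕜 f q q)
      (h.clm_apply (hasFDerivAt_id p))]
  simp [hs p β, add_comm]

namespace LieStructure

variable (𝔡 : LieStructure 𝕜 V) (j : E →L[𝕜] V)

/-- `((e^{ad_{j p}} - 1) / ad_{j p}) (j α)`, the value on `α` of the logarithmic derivative of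
`p ↦ e^{ad_{j p}}`. -/
def expOmega (p α : E) : V := expSubOneDiv (𝔡.bracket (j p)) (j α)

theorem analyticAt_bracket_comp (p : E) : AnalyticAt 𝕜 (fun q => 𝔡.bracket (j q)) p :=
  (𝔡.bracket.comp j).analyticAt p

theorem expOmega_zero (α : E) : 𝔡.expOmega j 0 α = j α := by
  simp [expOmega, expSubOneDiv_zero]

theorem fderiv_bracket {f g : E → V} {p : E} (hf : DifferentiableAt 𝕜 f p)
    (hg : DifferentiableAt 𝕜 g p) (β : E) :
    fderiv 𝕜 (fun q => 𝔡.bracket (f q) (g q)) p β =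
      𝔡.bracket (fderiv 𝕜 f p β) (g p) + 𝔡.bracket (f p) (fderiv 𝕜 g p β) := by
  rw [(𝔡.bracket.hasFDerivAt_of_bilinear hf.hasFDerivAt hg.hasFDerivAt).fderiv]
  simp [add_comm]

theorem fderiv_bracket_apply {f : E → V} {p : E} (hf : DifferentiableAt 𝕜 f p) (β : E) :
    fderiv 𝕜 (fun q => 𝔡.bracket (j q) (f q)) p β =
      𝔡.bracket (j β) (f p) + 𝔡.bracket (j p) (fderiv 𝕜 f p β) := by
  rw [𝔡.fderiv_bracket j.differentiableAt hf, j.fderiv]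

theorem _root_.AnalyticAt.lieStructure_bracket {f g : E → V} {p : E} (hf : AnalyticAt 𝕜 f p)
    (hg : AnalyticAt 𝕜 g p) : AnalyticAt 𝕜 (fun q => 𝔡.bracket (f q) (g q)) p :=
  ((𝔡.bracket.analyticAt (f p)).comp hf).clm_apply hg

/-- Radial uniqueness with B(p) = ad_{j p}, which is linear in p and so vanishes at 0. Each identity
for the exponential family is proved by applying this to the difference of its two sides. -/
theorem eq_zero_of_radial {f : E → V} (hf : ∀ p, AnalyticAt 𝕜 f p) (h0 : f 0 = 0) (c : ℕ)
    (h : ∀ p, fderiv 𝕜 f p p + (c : 𝕜) • f p = 𝔡.bracket (j p) (f p)) (p : E) : f p = 0 := by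
  let _ : NormedSpace ℝ E := NormedSpace.restrictScalars ℝ 𝕜 E
  exact AnalyticOnNhd.eq_zero_of_radial convex_univ.isPreconnected Filter.univ_mem
    (fun q _ => hf q) h0 c
    (B := fun q => 𝔡.bracket (j q)) (𝔡.analyticAt_bracket_comp j 0).differentiableAt (by simp)
    (Filter.Eventually.of_forall h) p (Set.mem_univ p)

variable [CompleteSpace V]

theorem analyticAt_expSubOneDiv_ad (p : E) :
    AnalyticAt 𝕜 (fun q => expSubOneDiv (𝔡.bracket (j q))) p :=
  (analyticAt_expSubOneDiv _).comp (𝔡.analyticAt_bracket_comp j p)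

theorem analyticAt_expSeriesSum_ad (p : E) :
    AnalyticAt 𝕜 (fun q => expSeriesSum (𝔡.bracket (j q))) p := by
  simp_rw [expSeriesSum_eq_one_add]
  exact analyticAt_const.add
    ((𝔡.analyticAt_bracket_comp j p).mul (𝔡.analyticAt_expSubOneDiv_ad j p))

theorem analyticAt_expOmega (p α : E) : AnalyticAt 𝕜 (fun q => 𝔡.expOmega j q α) p :=
  (𝔡.analyticAt_expSubOneDiv_ad j p).clm_apply analyticAt_const

theorem analyticAt_expSeriesSum_ad_apply (X : V) (p : E) :
    AnalyticAt 𝕜 (fun q => expSeriesSum (𝔡.bracket (j q)) X) p :=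
  (𝔡.analyticAt_expSeriesSum_ad j p).clm_apply analyticAt_const

theorem expSeriesSum_apply_eq (p : E) (X : V) : expSeriesSum (𝔡.bracket (j p)) X =
    X + 𝔡.bracket (j p) (expSubOneDiv (𝔡.bracket (j p)) X) := by
  rw [expSeriesSum_eq_one_add]; rfl

theorem expSeriesSum_ad_zero (X : V) : expSeriesSum (𝔡.bracket (j 0)) X = X := by
  rw [expSeriesSum_apply_eq]; simp

/-- Since p ↦ ad_{j p} is linear, the radial derivative is the derivative of Φ(A) = (e^A - 1)/A in
the direction A, and e^A = 1 + A Φ(A). -/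
theorem radial_expSubOneDiv (p : E) (X : V) :
    fderiv 𝕜 (fun q => expSubOneDiv (𝔡.bracket (j q)) X) p p +
      expSubOneDiv (𝔡.bracket (j p)) X =
      𝔡.bracket (j p) (expSubOneDiv (𝔡.bracket (j p)) X) + X := by
  have h := ((analyticAt_expSubOneDiv (𝔡.bracket (j p))).differentiableAt.hasFDerivAt.comp p
    (𝔡.bracket.comp j).hasFDerivAt).clm_apply (hasFDerivAt_const X p)
  have e := h.fderiv
  simp only [Function.comp_def, ContinuousLinearMap.comp_apply] at e
  rw [e]
  have h2 := congrArg (fun A : V →L[𝕜] V => A X) (fderiv_expSubOneDiv_self (𝔡.bracket (j p)))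
  simp only [sub_apply, expSeriesSum_apply_eq] at h2
  simp [h2, add_comm]

theorem radial_expOmega (p α : E) :
    fderiv 𝕜 (fun q => 𝔡.expOmega j q α) p p + 𝔡.expOmega j p α =
      𝔡.bracket (j p) (𝔡.expOmega j p α) + j α :=
  𝔡.radial_expSubOneDiv j p (j α)

theorem radial_expSeriesSum (p : E) (X : V) :
    fderiv 𝕜 (fun q => expSeriesSum (𝔡.bracket (j q)) X) p p =
      𝔡.bracket (j p) (expSeriesSum (𝔡.bracket (j p)) X) := by
  have hd : DifferentiableAt 𝕜 (fun q => expSubOneDiv (𝔡.bracket (j q)) X) p :=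
    ((𝔡.analyticAt_expSubOneDiv_ad j p).clm_apply analyticAt_const).differentiableAt
  simp_rw [expSeriesSum_apply_eq]
  rw [fderiv_const_add, 𝔡.fderiv_bracket_apply j hd, ← map_add, add_comm,
    𝔡.radial_expSubOneDiv, add_comm X, add_comm]

/-- `e^{ad_{j p}}` is an automorphism. -/
theorem expSeriesSum_bracket (p : E) (X Y : V) :
    expSeriesSum (𝔡.bracket (j p)) (𝔡.bracket X Y) =
      𝔡.bracket (expSeriesSum (𝔡.bracket (j p)) X) (expSeriesSum (𝔡.bracket (j p)) Y) := by
  have hA := 𝔡.analyticAt_expSeriesSum_ad_apply j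
  -- Here c = 0: by the Jacobi identity, the radial derivative of either side is ad_{j q} applied to
  -- it, and the two sides agree at 0.
  refine sub_eq_zero.1 (𝔡.eq_zero_of_radial j (f := fun q =>
    expSeriesSum (𝔡.bracket (j q)) (𝔡.bracket X Y) -
      𝔡.bracket (expSeriesSum (𝔡.bracket (j q)) X) (expSeriesSum (𝔡.bracket (j q)) Y))
    (fun q => (hA _ q).sub ((hA X q).lieStructure_bracket 𝔡 (hA Y q)))
    (by simp only [expSeriesSum_ad_zero, sub_self]) 0 (fun q => ?_) p)
  have hbr := (hA X q).lieStructure_bracket 𝔡 (hA Y q)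
  rw [fderiv_fun_sub (hA _ q).differentiableAt hbr.differentiableAt, sub_apply,
    𝔡.fderiv_bracket (hA X q).differentiableAt (hA Y q).differentiableAt, radial_expSeriesSum,
    radial_expSeriesSum, radial_expSeriesSum, map_sub, 𝔡.jacobi (j q) (expSeriesSum _ X)]
  simp

/-- `p ↦ e^{ad_{j p}}` has logarithmic derivative `ad ∘ expOmega`. -/
theorem fderiv_expSeriesSum_ad (p β : E) (X : V) :
    fderiv 𝕜 (fun q => expSeriesSum (𝔡.bracket (j q)) X) p β =
      𝔡.bracket (𝔡.expOmega j p β) (expSeriesSum (𝔡.bracket (j p)) X) := by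
  have hA := 𝔡.analyticAt_expSeriesSum_ad_apply j X
  have hω := fun q => 𝔡.analyticAt_expOmega j q β
  have hdA : ∀ q, AnalyticAt 𝕜 (fun q => fderiv 𝕜 (fun q => expSeriesSum (𝔡.bracket (j q)) X) q β)
    q := fun q => (hA q).fderiv.clm_apply analyticAt_const
  -- The radial equation of e^{ad} differentiated in the direction β: the constant rises from 0 to
  -- 1, and at q = 0 the equation yields the initial value.
  have hR : ∀ q, fderiv 𝕜 (fun q => fderiv 𝕜 (fun q => expSeriesSum (𝔡.bracket (j q)) X) q β) q q
      + fderiv 𝕜 (fun q => expSeriesSum (𝔡.bracket (j q)) X) q β =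
      𝔡.bracket (j β) (expSeriesSum (𝔡.bracket (j q)) X) +
        𝔡.bracket (j q) (fderiv 𝕜 (fun q => expSeriesSum (𝔡.bracket (j q)) X) q β) := by
    intro q
    rw [fderiv_radial_fderiv (hA q), ← 𝔡.fderiv_bracket_apply j (hA q).differentiableAt]
    simp_rw [radial_expSeriesSum]
  refine sub_eq_zero.1 (𝔡.eq_zero_of_radial j (f := fun q =>
    fderiv 𝕜 (fun q => expSeriesSum (𝔡.bracket (j q)) X) q β -
      𝔡.bracket (𝔡.expOmega j q β) (expSeriesSum (𝔡.bracket (j q)) X))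
    (fun q => (hdA q).sub ((hω q).lieStructure_bracket 𝔡 (hA q))) ?_ 1
    (fun q => ?_) p)
  · have h1 := hR 0
    simp only [map_zero, zero_add, zero_apply, add_zero] at h1
    simpa [expOmega_zero, sub_eq_zero] using h1
  · have hbr := (hω q).lieStructure_bracket 𝔡 (hA q)
    rw [fderiv_fun_sub (hdA q).differentiableAt hbr.differentiableAt, sub_apply,
      𝔡.fderiv_bracket (hω q).differentiableAt (hA q).differentiableAt, radial_expSeriesSum,
      eq_sub_of_add_eq (hR q), eq_sub_of_add_eq (𝔡.radial_expOmega j q β), map_sub (𝔡.bracket (j q)),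
      𝔡.jacobi (j q) (𝔡.expOmega j q β)]
    simp
    abel

/-- The Maurer–Cartan equation for the logarithmic derivative of `p ↦ e^{ad_{j p}}`. -/
theorem fderiv_expOmega_sub (p β γ : E) :
    fderiv 𝕜 (fun q => 𝔡.expOmega j q γ) p β - fderiv 𝕜 (fun q => 𝔡.expOmega j q β) p γ =
      𝔡.bracket (𝔡.expOmega j p β) (𝔡.expOmega j p γ) := by
  have hω := fun α q => 𝔡.analyticAt_expOmega j q α
  have hd : ∀ α β q, AnalyticAt 𝕜 (fun q => fderiv 𝕜 (fun q => 𝔡.expOmega j q α) q β)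
    q := fun α β q => (hω α q).fderiv.clm_apply analyticAt_const
  -- The radial equation of `expOmega`, with constant 1, differentiated in the direction β; this is
  -- why c = 2 below.
  have hR : ∀ α β q, fderiv 𝕜 (fun q => fderiv 𝕜 (fun q => 𝔡.expOmega j q α) q β) q q =
      𝔡.bracket (j β) (𝔡.expOmega j q α) +
        𝔡.bracket (j q) (fderiv 𝕜 (fun q => 𝔡.expOmega j q α) q β)
      - fderiv 𝕜 (fun q => 𝔡.expOmega j q α) q β - fderiv 𝕜 (fun q => 𝔡.expOmega j q α) q β := by
    intro α β q
    refine eq_sub_of_add_eq ((fderiv_radial_fderiv (hω α q) β).trans ?_)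
    rw [← 𝔡.fderiv_bracket_apply j (hω α q).differentiableAt]
    simp_rw [eq_sub_of_add_eq (𝔡.radial_expOmega j _ α), add_sub_right_comm _ (j α)]
    rw [fderiv_add_const]
    have hbr := (j.analyticAt q).lieStructure_bracket 𝔡 (hω α q)
    rw [fderiv_fun_sub hbr.differentiableAt (hω α q).differentiableAt, sub_apply]
  refine sub_eq_zero.1 (𝔡.eq_zero_of_radial j (f := fun q =>
    fderiv 𝕜 (fun q => 𝔡.expOmega j q γ) q β - fderiv 𝕜 (fun q => 𝔡.expOmega j q β) q γ -
      𝔡.bracket (𝔡.expOmega j q β) (𝔡.expOmega j q γ))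
    (fun q => ((hd γ β q).sub (hd β γ q)).sub
      ((hω β q).lieStructure_bracket 𝔡 (hω γ q))) ?_ 2
    (fun q => ?_) p)
  · have h1 := hR γ β 0
    have h2 := hR β γ 0
    simp only [map_zero, zero_apply, add_zero, expOmega_zero] at h1 h2
    have h3 := 𝔡.bracket_skew (j γ) (j β)
    simp only [expOmega_zero]
    -- At 0, `hR` determines only twice each derivative: 2 d_0 ω_γ(β) = [jβ, jγ].
    have h4 : (2 : 𝕜) • (fderiv 𝕜 (fun q => 𝔡.expOmega j q γ) 0 β -
      fderiv 𝕜 (fun q => 𝔡.expOmega j q β) 0 γ - 𝔡.bracket (j β) (j γ)) = 0 := by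
      rw [h3] at h2
      linear_combination (norm := module) h1 - h2
    exact (smul_eq_zero.1 h4).resolve_left two_ne_zero
  · have hbr := (hω β q).lieStructure_bracket 𝔡 (hω γ q)
    rw [fderiv_fun_sub ((hd γ β q).fun_sub (hd β γ q)).differentiableAt hbr.differentiableAt, sub_apply,
      fderiv_fun_sub (hd γ β q).differentiableAt (hd β γ q).differentiableAt, sub_apply,
      𝔡.fderiv_bracket (hω β q).differentiableAt (hω γ q).differentiableAt, hR, hR,
      eq_sub_of_add_eq (𝔡.radial_expOmega j q β), eq_sub_of_add_eq (𝔡.radial_expOmega j q γ),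
      map_sub (𝔡.bracket (j q)), map_sub (𝔡.bracket (j q)), 𝔡.jacobi (j q) (𝔡.expOmega j q β), 𝔡.bracket_skew (j γ)]
    simp [two_smul]
    abel

theorem fderiv_expSeriesSum_section {X : E → V} {p : E} (hX : DifferentiableAt 𝕜 X p) (β : E) :
    fderiv 𝕜 (fun q => expSeriesSum (𝔡.bracket (j q)) (X q)) p β =
      𝔡.bracket (𝔡.expOmega j p β) (expSeriesSum (𝔡.bracket (j p)) (X p)) +
        expSeriesSum (𝔡.bracket (j p)) (fderiv 𝕜 X p β) := by
  have hA := (𝔡.analyticAt_expSeriesSum_ad j p).differentiableAt.hasFDerivAt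
  have h1 := (hA.clm_apply (hasFDerivAt_const (X p) p)).fderiv
  rw [(hA.clm_apply hX.hasFDerivAt).fderiv, ← 𝔡.fderiv_expSeriesSum_ad j p β (X p), h1]
  simp [add_comm]

theorem fderiv_expOmega_section {α : E → E} {p : E} (hα : DifferentiableAt 𝕜 α p) (β : E) :
    fderiv 𝕜 (fun q => 𝔡.expOmega j q (α q)) p β =
      fderiv 𝕜 (fun q => 𝔡.expOmega j q (α p)) p β + 𝔡.expOmega j p (fderiv 𝕜 α p β) := by
  have hA := (𝔡.analyticAt_expSubOneDiv_ad j p).differentiableAt.hasFDerivAt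
  have h1 := (hA.clm_apply (hasFDerivAt_const (j (α p)) p)).fderiv
  have h2 := (hA.clm_apply (j.hasFDerivAt.comp p hα.hasFDerivAt)).fderiv
  simp only [Function.comp_apply] at h2
  simp only [expOmega]
  rw [h1, h2]
  simp [add_comm]

theorem differentiableAt_expOmega_sub {α : E → E} {X : E → V} {p : E}
    (hα : DifferentiableAt 𝕜 α p) (hX : DifferentiableAt 𝕜 X p) :
    DifferentiableAt 𝕜
      (fun q => 𝔡.expOmega j q (α q) - expSeriesSum (𝔡.bracket (j q)) (X q)) p :=
  ((𝔡.analyticAt_expSubOneDiv_ad j p).differentiableAt.clm_apply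
    (j.differentiableAt.comp p hα)).fun_sub
    ((𝔡.analyticAt_expSeriesSum_ad j p).differentiableAt.clm_apply hX)

theorem fderiv_expOmega_sub_section {α : E → E} {X : E → V} {p : E}
    (hα : DifferentiableAt 𝕜 α p) (hX : DifferentiableAt 𝕜 X p) (β : E) :
    fderiv 𝕜 (fun q => 𝔡.expOmega j q (α q) - expSeriesSum (𝔡.bracket (j q)) (X q)) p β =
      fderiv 𝕜 (fun q => 𝔡.expOmega j q (α p)) p β + 𝔡.expOmega j p (fderiv 𝕜 α p β) -
      (𝔡.bracket (𝔡.expOmega j p β) (expSeriesSum (𝔡.bracket (j p)) (X p)) +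
        expSeriesSum (𝔡.bracket (j p)) (fderiv 𝕜 X p β)) := by
  have h1 : DifferentiableAt 𝕜 (fun q => 𝔡.expOmega j q (α q)) p :=
    (𝔡.analyticAt_expSubOneDiv_ad j p).differentiableAt.clm_apply
      (j.differentiableAt.comp p hα)
  have h2 : DifferentiableAt 𝕜 (fun q => expSeriesSum (𝔡.bracket (j q)) (X q)) p :=
    (𝔡.analyticAt_expSeriesSum_ad j p).differentiableAt.clm_apply hX
  rw [fderiv_fun_sub h1 h2, sub_apply, 𝔡.fderiv_expOmega_section j hα,
    𝔡.fderiv_expSeriesSum_section j hX]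

/-- The gauge transformation `(α, X) ↦ (α, e^{ad_{j p}} X - expOmega α)` is compatible with the
brackets of the trivial Lie algebroid. -/
theorem bracket_gauge {α α' : E → E} {X X' : E → V} {p : E}
    (hα : DifferentiableAt 𝕜 α p) (hα' : DifferentiableAt 𝕜 α' p)
    (hX : DifferentiableAt 𝕜 X p) (hX' : DifferentiableAt 𝕜 X' p) :
    fderiv 𝕜 (fun q => 𝔡.expOmega j q (α' q) - expSeriesSum (𝔡.bracket (j q)) (X' q)) p (α p) -
      fderiv 𝕜 (fun q => 𝔡.expOmega j q (α q) - expSeriesSum (𝔡.bracket (j q)) (X q)) p (α' p) -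
      𝔡.bracket (𝔡.expOmega j p (α p) - expSeriesSum (𝔡.bracket (j p)) (X p))
        (𝔡.expOmega j p (α' p) - expSeriesSum (𝔡.bracket (j p)) (X' p)) =
      𝔡.expOmega j p (VectorField.lieBracket 𝕜 α α' p) -
      expSeriesSum (𝔡.bracket (j p))
        (fderiv 𝕜 X' p (α p) - fderiv 𝕜 X p (α' p) + 𝔡.bracket (X p) (X' p)) := by
  -- The ω–ω terms are the Maurer–Cartan equation, the mixed terms cancel by the logarithmic
  -- derivative of e^{ad}, and the remaining bracket is handled by the automorphism property.
  have hmc := 𝔡.fderiv_expOmega_sub j p (α p) (α' p)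
  rw [𝔡.fderiv_expOmega_sub_section j hα' hX', 𝔡.fderiv_expOmega_sub_section j hα hX,
    sub_eq_iff_eq_add.1 hmc]
  have hω : 𝔡.expOmega j p (VectorField.lieBracket 𝕜 α α' p) =
      𝔡.expOmega j p (fderiv 𝕜 α' p (α p)) - 𝔡.expOmega j p (fderiv 𝕜 α p (α' p)) := by
    simp only [expOmega, VectorField.lieBracket, map_sub]
  rw [hω, map_add, map_sub, 𝔡.expSeriesSum_bracket]
  simp only [map_sub, sub_apply]
  rw [𝔡.bracket_skew (expSeriesSum (𝔡.bracket (j p)) (X p)) (𝔡.expOmega j p (α' p))]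
  abel

end LieStructure

end ExponentialFamily

/-! ### Analyticity of the coadjoint action. -/

namespace LieStructure

variable {𝕜 E V : Type*} [RCLike 𝕜] [NormedAddCommGroup E] [NormedSpace 𝕜 E]
  [NormedAddCommGroup V] [NormedSpace 𝕜 V] (A : LieStructure 𝕜 V)

/-- The coadjoint action as the bilinear map `(ξ, x) ↦ ad^*_x ξ`. -/
def adStarL : StrongDual 𝕜 V →L[𝕜] V →L[𝕜] StrongDual 𝕜 V :=
  ((ContinuousLinearMap.compL 𝕜 V (V →L[𝕜] V) (StrongDual 𝕜 V)).flip
    A.bracket).comp (ContinuousLinearMap.compL 𝕜 V V 𝕜)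

theorem _root_.AnalyticAt.lieStructure_adStar {x : E → V} {ξ : E → StrongDual 𝕜 V} {p : E}
    (hx : AnalyticAt 𝕜 x p) (hξ : AnalyticAt 𝕜 ξ p) :
    AnalyticAt 𝕜 (fun q => A.adStar (x q) (ξ q)) p :=
  (A.adStarL.analyticAt_bilinear (ξ p, x p)).comp (f := fun q => (ξ q, x q)) (hξ.prod hx)

end LieStructure

namespace LieQuasiBialgebra.ReductiveDecomposition

variable {𝕜 𝔤 : Type*} [RCLike 𝕜] [NormedAddCommGroup 𝔤] [NormedSpace 𝕜 𝔤]
  [FiniteDimensional 𝕜 𝔤] {Q : LieQuasiBialgebra 𝕜 𝔤} (D : Q.ReductiveDecomposition)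

/-! ### Projections and duals -/

@[simp]
theorem projL_coe (z : D.L) : D.projL z = z :=
  Submodule.projectionOnto_apply_left D.isCompl z

theorem projL_of_mem_M {y : 𝔤} (hy : y ∈ D.M) : D.projL y = 0 :=
  (Submodule.projectionOnto_apply_eq_zero_iff D.isCompl).2 hy

theorem sub_projL_mem (y : 𝔤) : y - D.projL y ∈ D.M := by
  rw [← Submodule.projectionOnto_apply_eq_zero_iff D.isCompl]
  change D.projL (y - D.projL y) = 0
  simp

/-- Reductivity: ad_z preserves M, hence commutes with the projection. -/
theorem projL_bracket (z : D.L) (y : 𝔤) :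
    D.projL (Q.bracket z y) = D.lieL.bracket z (D.projL y) := by
  have h := D.projL_of_mem_M (D.bracket_mem_M z z.2 _ (D.sub_projL_mem y))
  rw [map_sub, map_sub, sub_eq_zero] at h
  rw [h]
  exact D.projL_coe (D.lieL.bracket z (D.projL y))

theorem projL_bracket' (y : 𝔤) (z : D.L) :
    D.projL (Q.bracket y z) = D.lieL.bracket (D.projL y) z := by
  rw [Q.bracket_skew, map_neg, projL_bracket, ← D.lieL.bracket_skew]

theorem s_apply (α : StrongDual 𝕜 D.L) (y : 𝔤) : D.s α y = α (D.projL y) := rfl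

theorem iStar_apply (ξ : StrongDual 𝕜 𝔤) (z : D.L) : D.iStar ξ z = ξ z := rfl

@[simp]
theorem iStar_s (α : StrongDual 𝕜 D.L) : D.iStar (D.s α) = α := by
  ext z
  simp [iStar_apply, s_apply]

/-- `s` as a continuous linear map. -/
def sL : StrongDual 𝕜 D.L →L[𝕜] StrongDual 𝕜 𝔤 :=
  (ContinuousLinearMap.compL 𝕜 𝔤 D.L 𝕜).flip D.projL

@[simp] theorem sL_apply (α : StrongDual 𝕜 D.L) : D.sL α = D.s α := rfl

/-- `i^*` as a continuous linear map. -/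
def iStarL : StrongDual 𝕜 𝔤 →L[𝕜] StrongDual 𝕜 D.L :=
  (ContinuousLinearMap.compL 𝕜 D.L 𝔤 𝕜).flip D.L.subtypeL

@[simp] theorem iStarL_apply (ξ : StrongDual 𝕜 𝔤) : D.iStarL ξ = D.iStar ξ := rfl

/-- The coadjoint action of `L`, as the bilinear map `(p, z) ↦ ad^*_z p`. -/
def adStarL : StrongDual 𝕜 D.L →L[𝕜] D.L →L[𝕜] StrongDual 𝕜 D.L := D.lieL.adStarL

@[simp] theorem adStarL_apply (p : StrongDual 𝕜 D.L) (z : D.L) :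
    D.adStarL p z = D.lieL.adStar z p := rfl

/-- `p ↦ s p`, with values in the double. -/
def sDouble : StrongDual 𝕜 D.L →L[𝕜] 𝔤 × StrongDual 𝕜 𝔤 :=
  (ContinuousLinearMap.inr 𝕜 𝔤 (StrongDual 𝕜 𝔤)).comp D.sL

theorem sDouble_apply (p : StrongDual 𝕜 D.L) : D.sDouble p = (0, D.s p) := rfl

theorem adS_eq (p : StrongDual 𝕜 D.L) : D.adS p = Q.double.bracket (D.sDouble p) := rfl

theorem AdExp_eq (p : StrongDual 𝕜 D.L) :
    D.AdExp p = expSeriesSum (Q.double.bracket (D.sDouble p)) := rfl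

theorem omega_eq (p α : StrongDual 𝕜 D.L) :
    D.omega p α = Q.double.expOmega D.sDouble p α := rfl

theorem adS_apply (p : StrongDual 𝕜 D.L) (Y : 𝔤 × StrongDual 𝕜 𝔤) :
    D.adS p Y = (Q.phi (D.s p) Y.2 - Q.varpi Y.1 (D.s p),
      Q.adStar Y.1 (D.s p) - Q.coPair (D.s p) Y.2) := by
  change Q.doubleBracket _ _ = _
  rw [doubleBracket_apply]
  ext y
  · simp [sub_eq_neg_add]
  · simp

/-- Since ϖ vanishes on L, no 𝔤-component appears; reductivity makes the dual component factor
through L. With `iStar_adS`, this is the source of the term ad^*_z p in the anchor. -/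
theorem adS_coe_L (p : StrongDual 𝕜 D.L) (z : D.L) :
    D.adS p ((z : 𝔤), 0) = (0, D.s (D.lieL.adStar z p)) := by
  rw [adS_apply]
  ext y
  · simp [D.varpi_L z z.2]
  · simp [s_apply, projL_bracket]

theorem iStar_adS (p : StrongDual 𝕜 D.L) (Y : 𝔤 × StrongDual 𝕜 𝔤) :
    D.iStar (D.adS p Y).2 = D.lieL.adStar (D.projL Y.1) p := by
  rw [adS_apply]
  ext w
  simp [iStar_apply, s_apply, projL_bracket', D.varpi_L w w.2]

/-! ### Analytic continuation of the equations of the canonical `ℓ`-matrix -/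

section Continuation

variable {D} {U : Set (StrongDual 𝕜 D.L)} {l : StrongDual 𝕜 D.L → StrongDual 𝕜 𝔤 →L[𝕜] 𝔤}

/-- For fixed arguments each equation is an analytic identity in p, so the identity theorem extends
it from the germ at 0. -/
theorem isDynamicalAt_of_isPreconnected (hU : IsPreconnected U) (h0 : (0 : StrongDual 𝕜 D.L) ∈ U)
    (hl : AnalyticOnNhd 𝕜 l U) (hdyn : ∀ᶠ p in 𝓝 0, D.IsDynamicalAt l p) :
    ∀ p ∈ U, D.IsDynamicalAt l p := by
  have : CompleteSpace 𝔤 := FiniteDimensional.complete 𝕜 𝔤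
  have key : ∀ f : StrongDual 𝕜 D.L → 𝕜, AnalyticOnNhd 𝕜 f U → (∀ᶠ p in 𝓝 0, f p = 0) →
      ∀ p ∈ U, f p = 0 := fun f hf h =>
    hf.eqOn_zero_of_preconnected_of_eventuallyEq_zero hU h0 h
  have key' : ∀ f : StrongDual 𝕜 D.L → 𝔤, AnalyticOnNhd 𝕜 f U → (∀ᶠ p in 𝓝 0, f p = 0) →
      ∀ p ∈ U, f p = 0 := fun f hf h =>
    hf.eqOn_zero_of_preconnected_of_eventuallyEq_zero hU h0 h
  have hlξ : ∀ ξ, ∀ p ∈ U, AnalyticAt 𝕜 (fun q => l q ξ) p := fun ξ p hp =>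
    (hl p hp).clm_apply analyticAt_const
  have hξ : ∀ (ξ : StrongDual 𝕜 𝔤) {f : StrongDual 𝕜 D.L → 𝔤} {p}, AnalyticAt 𝕜 f p →
      AnalyticAt 𝕜 (fun q => ξ (f q)) p := fun ξ f p hf => (ξ.analyticAt _).comp hf
  have hdl : ∀ β η, ∀ p ∈ U, AnalyticAt 𝕜 (fun q => fderiv 𝕜 l q β η) p := fun β η p hp =>
    ((hl p hp).fderiv.clm_apply analyticAt_const).clm_apply analyticAt_const
  have hbr : ∀ ξ η, ∀ p ∈ U, AnalyticAt 𝕜 (fun q => Q.bracket (l q ξ) (l q η)) p :=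
    fun ξ η p hp => (hlξ ξ p hp).lieStructure_bracket Q.toLieStructure (hlξ η p hp)
  have hva : ∀ ξ η, ∀ p ∈ U, AnalyticAt 𝕜 (fun q => Q.varpi (l q ξ) η) p := fun ξ η p hp =>
    ((Q.varpi.analyticAt _).comp (hlξ ξ p hp)).clm_apply analyticAt_const
  have hterm : ∀ (ξ η ζ : StrongDual 𝕜 𝔤), ∀ p ∈ U, AnalyticAt 𝕜 (fun q =>
      ζ (fderiv 𝕜 l q (D.iStar ξ) η) - ζ (Q.bracket (l q ξ) (l q η)) - ζ (Q.varpi (l q ξ) η)) p :=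
    fun ξ η ζ p hp => ((hξ ζ (hdl _ η p hp)).sub (hξ ζ (hbr ξ η p hp))).sub (hξ ζ (hva ξ η p hp))
  refine fun p hp => ⟨fun ξ η => ?_, fun ξ η ζ => ?_, fun z ξ => ?_⟩
  · refine eq_neg_of_add_eq_zero_left (key (fun p => ξ (l p η) + η (l p ξ))
      (fun p hp => (hξ ξ (hlξ η p hp)).add (hξ η (hlξ ξ p hp))) ?_ p hp)
    filter_upwards [hdyn] with q hq
    rw [hq.skew ξ η, neg_add_cancel]
  · refine sub_eq_zero.1 (key (fun p =>
      (ζ (fderiv 𝕜 l p (D.iStar ξ) η) - ζ (Q.bracket (l p ξ) (l p η)) - ζ (Q.varpi (l p ξ) η))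
      + (ξ (fderiv 𝕜 l p (D.iStar η) ζ) - ξ (Q.bracket (l p η) (l p ζ)) - ξ (Q.varpi (l p η) ζ))
      + (η (fderiv 𝕜 l p (D.iStar ζ) ξ) - η (Q.bracket (l p ζ) (l p ξ)) - η (Q.varpi (l p ζ) ξ))
      - ζ (Q.phi ξ η)) (fun p hp => (((hterm ξ η ζ p hp).add (hterm η ζ ξ p hp)).add
        (hterm ζ ξ η p hp)).sub analyticAt_const) ?_ p hp)
    filter_upwards [hdyn] with q hq
    rw [hq.yangBaxter ξ η ζ, sub_self]
  · refine key' (fun p => fderiv 𝕜 l p (D.lieL.adStar z p) ξ + Q.varpi z ξ + Q.bracket z (l p ξ)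
      + l p (Q.adStar z ξ)) (fun p hp => ?_) ?_ p hp
    · have h1 : AnalyticAt 𝕜 (fun q => fderiv 𝕜 l q (D.lieL.adStar z q) ξ) p :=
        ((hl p hp).fderiv.clm_apply (analyticAt_const.lieStructure_adStar D.lieL analyticAt_id)).clm_apply analyticAt_const
      exact ((h1.add analyticAt_const).add
        (((Q.bracket (z : 𝔤)).analyticAt _).comp (hlξ ξ p hp))).add (hlξ _ p hp)
    · filter_upwards [hdyn] with q hq using hq.equivariance z ξ

theorem apply_s_of_isPreconnected (hU : IsPreconnected U) (h0 : (0 : StrongDual 𝕜 D.L) ∈ U)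
    (hl : AnalyticOnNhd 𝕜 l U) (hs : ∀ᶠ p in 𝓝 0, l p (D.s p) = 0) :
    ∀ p ∈ U, l p (D.s p) = 0 :=
  AnalyticOnNhd.eqOn_zero_of_preconnected_of_eventuallyEq_zero (f := fun p => l p (D.s p))
    (fun p hp => (hl p hp).clm_apply (D.sL.analyticAt p)) hU h0 hs

theorem fderiv_skew {p : StrongDual 𝕜 D.L} (hl : DifferentiableAt 𝕜 l p)
    (hskew : ∀ᶠ q in 𝓝 p, ∀ ξ η : StrongDual 𝕜 𝔤, ξ (l q η) = -η (l q ξ))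
    (β : StrongDual 𝕜 D.L) (ξ η : StrongDual 𝕜 𝔤) :
    ξ (fderiv 𝕜 l p β η) = -η (fderiv 𝕜 l p β ξ) := by
  have h : ∀ ξ η : StrongDual 𝕜 𝔤, fderiv 𝕜 (fun q => ξ (l q η)) p β = ξ (fderiv 𝕜 l p β η) := by
    intro ξ η
    have := (ξ.hasFDerivAt.comp p (hl.hasFDerivAt.clm_apply (hasFDerivAt_const η p))).fderiv
    simp only [Function.comp_def] at this
    rw [this]
    simp
  rw [← h, ← h]
  have e : (fun q => ξ (l q η)) =ᶠ[𝓝 p] fun q => -η (l q ξ) := hskew.mono fun q hq => hq ξ η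
  rw [e.fderiv_eq, fderiv_fun_neg]
  rfl

theorem fderiv_apply_s {p : StrongDual 𝕜 D.L} (hl : DifferentiableAt 𝕜 l p)
    (hs : ∀ᶠ q in 𝓝 p, l q (D.s q) = 0) (β : StrongDual 𝕜 D.L) :
    fderiv 𝕜 l p β (D.s p) = -l p (D.s β) := by
  have h := (hl.hasFDerivAt.clm_apply D.sL.hasFDerivAt).fderiv
  have e : (fun q => l q (D.sL q)) =ᶠ[𝓝 p] fun _ => 0 := hs
  rw [e.fderiv_eq, fderiv_fun_const] at h
  have h2 := congrArg (fun A => A β) h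
  simp only [Pi.zero_apply, zero_apply, add_apply, ContinuousLinearMap.comp_apply,
    ContinuousLinearMap.flip_apply, sL_apply] at h2
  exact eq_neg_of_add_eq_zero_right h2.symm

/-- The radial Riccati equation satisfied by a dynamical `ℓ`-matrix such that `l_p (s p) = 0`. -/
theorem radial_ellMatrix {p : StrongDual 𝕜 D.L} (hl : DifferentiableAt 𝕜 l p)
    (hdyn : ∀ᶠ q in 𝓝 p, D.IsDynamicalAt l q) (hs : ∀ᶠ q in 𝓝 p, l q (D.s q) = 0)
    (η : StrongDual 𝕜 𝔤) :
    fderiv 𝕜 l p p η + D.projL (l p η) + l p (D.s (D.iStar η)) =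
      (D.adS p (l p η, η)).1 - l p (D.adS p (l p η, η)).2 := by
  apply (SeparatingDual.eq_iff_forall_dual_eq (R := 𝕜)).2
  intro ζ
  have hp := hdyn.self_of_nhds
  have hsp := hs.self_of_nhds
  -- With first argument s p, the first derivative becomes radial; the other two reduce to
  -- undifferentiated terms, by skewness and the derivative of l_q (s q) = 0.
  have h1 := hp.yangBaxter (D.s p) η ζ
  have h2 := fderiv_skew hl (hdyn.mono fun q hq => hq.skew) (D.iStar η) (D.s p) ζ
  rw [fderiv_apply_s hl hs] at h2
  rw [h2, fderiv_apply_s hl hs, hsp, iStar_s] at h1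
  -- Skewness turns η(l_p s i^* ζ) into -ζ(p_L l_p η), whence the projection term.
  have h3 := hp.skew η (D.s (D.iStar ζ))
  rw [s_apply, iStar_apply] at h3
  have h4 := hp.skew ζ (Q.adStar (l p η) (D.s p) - Q.coPair (D.s p) η)
  have h5 := Q.varpi_skew (l p ζ) η (D.s p)
  have h6 := Q.varpi_skew (l p η) ζ (D.s p)
  simp only [adS_apply, map_add, map_sub, map_neg, sub_apply, LieStructure.adStar_apply,
    coPair_apply, map_zero, zero_apply] at h1 h4 ⊢
  linear_combination h1 + h3 + h4 + h5 + h6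

end Continuation
end LieQuasiBialgebra.ReductiveDecomposition

namespace LieQuasiBialgebra.ReductiveDecomposition

variable {𝕜 𝔤 : Type*} [RCLike 𝕜] [NormedAddCommGroup 𝔤] [NormedSpace 𝕜 𝔤]
  [FiniteDimensional 𝕜 𝔤] {Q : LieQuasiBialgebra 𝕜 𝔤} {D : Q.ReductiveDecomposition}
  {U : Set (StrongDual 𝕜 D.L)} {l : StrongDual 𝕜 D.L → StrongDual 𝕜 𝔤 →L[𝕜] 𝔤}

/-! ### Radial solutions in the double -/

/-- The map `(q, b) ↦ l_p (s b) + (τ_{-l_p} ad_{sp} q)_𝔤`, which governs radial equations. -/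
def radialCoeff (D : Q.ReductiveDecomposition)
    (l : StrongDual 𝕜 D.L → StrongDual 𝕜 𝔤 →L[𝕜] 𝔤) (p : StrongDual 𝕜 D.L) :
    𝔤 × StrongDual 𝕜 D.L →L[𝕜] 𝔤 :=
  (l p).comp (D.sL.comp (ContinuousLinearMap.snd 𝕜 𝔤 (StrongDual 𝕜 D.L))) +
    ((ContinuousLinearMap.fst 𝕜 𝔤 (StrongDual 𝕜 𝔤)).comp (D.adS p)
      - (l p).comp ((ContinuousLinearMap.snd 𝕜 𝔤 (StrongDual 𝕜 𝔤)).comp (D.adS p))).comp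
      ((ContinuousLinearMap.inl 𝕜 𝔤 (StrongDual 𝕜 𝔤)).comp
        (ContinuousLinearMap.fst 𝕜 𝔤 (StrongDual 𝕜 D.L)))

theorem radialCoeff_apply (p : StrongDual 𝕜 D.L) (v : 𝔤 × StrongDual 𝕜 D.L) :
    D.radialCoeff l p v =
      l p (D.s v.2) + ((D.adS p (v.1, 0)).1 - l p (D.adS p (v.1, 0)).2) := rfl

theorem differentiableAt_adS (p : StrongDual 𝕜 D.L) : DifferentiableAt 𝕜 D.adS p :=
  (Q.double.bracket.comp D.sDouble).differentiableAt

theorem adS_zero : D.adS 0 = 0 := by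
  rw [adS_eq, map_zero, map_zero]

theorem differentiableAt_radialCoeff {p : StrongDual 𝕜 D.L} (hl : DifferentiableAt 𝕜 l p) :
    DifferentiableAt 𝕜 (D.radialCoeff l) p := by
  have h := differentiableAt_adS (D := D) p
  exact (hl.clm_comp (differentiableAt_const _)).add
    ((((differentiableAt_const _).clm_comp h).sub
      (hl.clm_comp ((differentiableAt_const _).clm_comp h))).clm_comp (differentiableAt_const _))

theorem radialCoeff_zero (h0 : l 0 = 0) : D.radialCoeff l 0 = 0 := by
  ext v <;> simp [radialCoeff_apply, h0, adS_zero]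

theorem fderiv_fst_sub {p : StrongDual 𝕜 D.L} (hl : DifferentiableAt 𝕜 l p)
    {y : StrongDual 𝕜 D.L → 𝔤 × StrongDual 𝕜 𝔤} (hy : DifferentiableAt 𝕜 y p)
    (β : StrongDual 𝕜 D.L) : fderiv 𝕜 (fun q => (y q).1 - l q (y q).2) p β =
      (fderiv 𝕜 y p β).1 - (fderiv 𝕜 l p β (y p).2 + l p (fderiv 𝕜 y p β).2) := by
  have h := hy.hasFDerivAt.fst.fun_sub (hl.hasFDerivAt.clm_apply hy.hasFDerivAt.snd)
  rw [h.fderiv]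
  simp [add_comm]

theorem fderiv_sub_adStar {p : StrongDual 𝕜 D.L}
    {ξ : StrongDual 𝕜 D.L → StrongDual 𝕜 𝔤} {z : StrongDual 𝕜 D.L → D.L}
    (hξ : DifferentiableAt 𝕜 ξ p) (hz : DifferentiableAt 𝕜 z p) (β : StrongDual 𝕜 D.L) :
    fderiv 𝕜 (fun q => D.iStarL (ξ q) - D.adStarL q (z q)) p β =
      D.iStar (fderiv 𝕜 ξ p β) - (D.lieL.adStar (z p) β + D.lieL.adStar (fderiv 𝕜 z p β) p) := by
  have h := (D.iStarL.hasFDerivAt.comp p hξ.hasFDerivAt).fun_sub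
    (D.adStarL.hasFDerivAt_of_bilinear (hasFDerivAt_id p) hz.hasFDerivAt)
  have e := h.fderiv
  simp only [Function.comp_def, id] at e
  rw [e]
  simp [add_comm]

/-- The radial derivative of `(τ_{-l} y)_𝔤` for a solution `y` of the radial equation
`d_p y(p) + c y = ad_{sp} y + s α`. -/
theorem radial_fst_sub {p α : StrongDual 𝕜 D.L} {c : 𝕜} (hl : DifferentiableAt 𝕜 l p)
    (hdyn : ∀ᶠ q in 𝓝 p, D.IsDynamicalAt l q) (hs : ∀ᶠ q in 𝓝 p, l q (D.s q) = 0)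
    {y : StrongDual 𝕜 D.L → 𝔤 × StrongDual 𝕜 𝔤} (hy : DifferentiableAt 𝕜 y p)
    (hrad : fderiv 𝕜 y p p + c • y p = D.adS p (y p) + D.sDouble α)
    {x : 𝔤} (hx : x = (y p).1 - l p (y p).2) {a : StrongDual 𝕜 D.L}
    (ha : a = D.iStar (y p).2 - D.lieL.adStar (D.projL x) p) :
    fderiv 𝕜 (fun q => (y q).1 - l q (y q).2) p p + c • x =
      D.radialCoeff l p (x - D.projL x, a - α) + D.projL (l p (y p).2) := by
  have h1 := radial_ellMatrix hl hdyn hs (y p).2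
  have hrad1 := congrArg Prod.fst (eq_sub_of_add_eq hrad)
  have hrad2 := congrArg Prod.snd (eq_sub_of_add_eq hrad)
  -- This brings the right side of the Riccati equation to ad_{sp} y up to terms in x, so that the
  -- contributions of y cancel.
  have hy2 : (l p (y p).2, (y p).2) = y p - (x, 0) := by
    ext1 <;> simp [hx]
  have hx2 : ((x, 0) : 𝔤 × StrongDual 𝕜 𝔤) = (x - D.projL x, 0) + ((D.projL x : 𝔤), 0) := by
    ext1 <;> simp
  -- The L-part of x enters only through s(ad^*_{p_L x} p), which completes s i^* y₂ to s a. Hence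
  -- only the M-part of x and a - α survive.
  have hadx : D.adS p (x, 0) = D.adS p (x - D.projL x, 0) +
      (0, D.s (D.lieL.adStar (D.projL x) p)) := by
    rw [hx2, map_add, adS_coe_L]
  rw [hy2, map_sub, hadx] at h1
  rw [fderiv_fst_sub hl hy, hrad1, hrad2, eq_sub_of_add_eq (eq_sub_of_add_eq h1), radialCoeff_apply]
  have ha' : D.s (a - α) = D.s (D.iStar (y p).2) - D.s (D.lieL.adStar (D.projL x) p) - D.s α := by
    rw [ha]; rfl
  simp only [ha', sDouble_apply, Prod.fst_sub, Prod.snd_sub, Prod.fst_add, Prod.snd_add, map_add,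
    map_sub, Prod.smul_fst, Prod.smul_snd, map_smul, add_zero]
  rw [hx, smul_sub]
  abel

/-- Differentiating p in ad^*_{p_L x} p gives -ad^*_{p_L x} p, and differentiating x gives
-ad^*_{p_L w} p; both cancel against i^*(ad_{sp} y)₂. The condition on c and α cancels the source α
against c α; it covers (1, α) and (0, 0). -/
theorem radial_sub_adStar {p α : StrongDual 𝕜 D.L} {c : 𝕜} (hcα : c • α = α)
    {y : StrongDual 𝕜 D.L → 𝔤 × StrongDual 𝕜 𝔤} (hy : DifferentiableAt 𝕜 y p)
    (hrad : fderiv 𝕜 y p p + c • y p = D.adS p (y p) + D.sDouble α)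
    {x : StrongDual 𝕜 D.L → 𝔤} (hx : DifferentiableAt 𝕜 x p) {r w : 𝔤}
    (hw : (y p).1 = x p + w)
    (hxr : fderiv 𝕜 x p p + c • x p = r + D.projL w) :
    fderiv 𝕜 (fun q => D.iStarL (y q).2 - D.adStarL q (D.projL (x q))) p p
      + c • (D.iStar (y p).2 - D.lieL.adStar (D.projL (x p)) p - α)
      = -D.lieL.adStar (D.projL r) p := by
  have hpx := D.projL.hasFDerivAt.comp p hx.hasFDerivAt
  have hy2 := hy.hasFDerivAt.snd
  have har := fderiv_sub_adStar hy2.differentiableAt hpx.differentiableAt p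
  rw [hpx.fderiv, hy2.fderiv] at har
  simp only [Function.comp_apply] at har
  rw [har]
  have hrad2 := congrArg (fun Y => D.iStarL (Prod.snd Y)) hrad
  simp only [Prod.snd_add, Prod.smul_snd, map_add, map_smul, iStarL_apply, iStar_adS, sDouble_apply,
    iStar_s] at hrad2
  rw [hw] at hrad2
  have hpx' := congrArg (fun v => D.adStarL p (D.projL v)) hxr
  simp only [map_add, map_smul, projL_coe, adStarL_apply] at hpx'
  have e : D.lieL.adStar (D.projL (x p + w)) p =
      D.lieL.adStar (D.projL (x p)) p + D.lieL.adStar (D.projL w) p := by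
    simp only [← adStarL_apply, map_add]
  rw [e] at hrad2
  simp only [ContinuousLinearMap.comp_apply, ContinuousLinearMap.coe_snd']
  rw [eq_sub_of_add_eq hrad2, smul_sub, smul_sub, hcα, eq_sub_of_add_eq hpx']
  abel

/-- The linear map governing the radial equation of the pair formed by the `M`-component of
`(τ_{-l} y)_𝔤` and the defect of the anchor. -/
def radialMap (D : Q.ReductiveDecomposition)
    (l : StrongDual 𝕜 D.L → StrongDual 𝕜 𝔤 →L[𝕜] 𝔤) (p : StrongDual 𝕜 D.L) :
    𝔤 × StrongDual 𝕜 D.L →L[𝕜] 𝔤 × StrongDual 𝕜 D.L :=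
  ((ContinuousLinearMap.inl 𝕜 𝔤 (StrongDual 𝕜 D.L)).comp
      (ContinuousLinearMap.id 𝕜 𝔤 - D.L.subtypeL.comp D.projL)
    - (ContinuousLinearMap.inr 𝕜 𝔤 (StrongDual 𝕜 D.L)).comp
      ((D.adStarL p).comp D.projL)).comp (D.radialCoeff l p)

theorem radialMap_apply (p : StrongDual 𝕜 D.L) (v : 𝔤 × StrongDual 𝕜 D.L) :
    D.radialMap l p v = (D.radialCoeff l p v - D.projL (D.radialCoeff l p v),
      -D.lieL.adStar (D.projL (D.radialCoeff l p v)) p) := by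
  ext1 <;> simp [radialMap]

theorem differentiableAt_radialMap {p : StrongDual 𝕜 D.L} (hl : DifferentiableAt 𝕜 l p) :
    DifferentiableAt 𝕜 (D.radialMap l) p :=
  ((differentiableAt_const _).sub ((differentiableAt_const _).clm_comp
    (D.adStarL.differentiableAt.clm_comp (differentiableAt_const _)))).clm_comp
    (differentiableAt_radialCoeff hl)

theorem _root_.AnalyticAt.clm_comp_left {E V W : Type*} [NormedAddCommGroup E] [NormedSpace 𝕜 E]
    [NormedAddCommGroup V] [NormedSpace 𝕜 V] [NormedAddCommGroup W] [NormedSpace 𝕜 W]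
    (A : V →L[𝕜] W) {f : E → V} {p : E} (hf : AnalyticAt 𝕜 f p) :
    AnalyticAt 𝕜 (fun q => A (f q)) p :=
  (A.analyticAt _).comp hf

/-- The pair (M-part of x, a - α), with x = (τ_{-l} y)_𝔤 and a the anchor of (p_L x, y₂), satisfies
a closed linear radial system with operator `radialMap`. This operator vanishes at 0 because l_0 = 0
and ad_{s0} = 0, and the initial conditions on y make the pair vanish there. -/
theorem eq_zero_of_radial_double (hU : IsOpen U) (hUc : IsPreconnected U)
    (h0 : (0 : StrongDual 𝕜 D.L) ∈ U)
    (hl : AnalyticOnNhd 𝕜 l U) (hdyn : ∀ p ∈ U, D.IsDynamicalAt l p)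
    (hs : ∀ p ∈ U, l p (D.s p) = 0) (hl0 : l 0 = 0)
    {y : StrongDual 𝕜 D.L → 𝔤 × StrongDual 𝕜 𝔤} (hy : ∀ p, AnalyticAt 𝕜 y p)
    {α : StrongDual 𝕜 D.L} (c : ℕ) (hcα : (c : 𝕜) • α = α)
    (hrad : ∀ p, fderiv 𝕜 y p p + (c : 𝕜) • y p = D.adS p (y p) + D.sDouble α)
    (hy01 : (y 0).1 ∈ D.L) (hy02 : D.iStar (y 0).2 = α) :
    ∀ p ∈ U, (y p).1 - l p (y p).2 = D.projL ((y p).1 - l p (y p).2) ∧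
      D.iStar (y p).2 - D.lieL.adStar (D.projL ((y p).1 - l p (y p).2)) p = α := by
  obtain ⟨x, hxdef⟩ : ∃ x : StrongDual 𝕜 D.L → 𝔤, x = fun p => (y p).1 - l p (y p).2 := ⟨_, rfl⟩
  obtain ⟨a, hadef⟩ : ∃ a : StrongDual 𝕜 D.L → StrongDual 𝕜 D.L,
    a = fun p => D.iStarL (y p).2 - D.adStarL p (D.projL (x p)) := ⟨_, rfl⟩
  have hy1 : ∀ p, AnalyticAt 𝕜 (fun q => (y q).1) p := fun p =>
    (hy p).clm_comp_left (ContinuousLinearMap.fst 𝕜 𝔤 (StrongDual 𝕜 𝔤))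
  have hy2 : ∀ p, AnalyticAt 𝕜 (fun q => (y q).2) p := fun p =>
    (hy p).clm_comp_left (ContinuousLinearMap.snd 𝕜 𝔤 (StrongDual 𝕜 𝔤))
  have hx : ∀ p ∈ U, AnalyticAt 𝕜 x p := by
    intro p hp
    rw [hxdef]
    exact (hy1 p).fun_sub ((hl p hp).clm_apply (hy2 p))
  have ha : ∀ p ∈ U, AnalyticAt 𝕜 a p := by
    intro p hp
    rw [hadef]
    have h1 : AnalyticAt 𝕜 (fun q => D.iStarL (y q).2) p := (hy2 p).clm_comp_left D.iStarL
    have h2 : AnalyticAt 𝕜 (fun q => D.projL (x q)) p := (hx p hp).clm_comp_left D.projL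
    exact h1.fun_sub (h2.lieStructure_adStar D.lieL analyticAt_id)
  have hPx : ∀ p ∈ U, AnalyticAt 𝕜 (fun q => (D.projL (x q) : 𝔤)) p := fun p hp =>
    (hx p hp).clm_comp_left (D.L.subtypeL.comp D.projL)
  have hf : AnalyticOnNhd 𝕜 (fun p => (x p - D.projL (x p), a p - α)) U := fun p hp =>
    ((hx p hp).fun_sub (hPx p hp)).prod ((ha p hp).fun_sub analyticAt_const)
  have hx0 : x 0 = (y 0).1 := by simp [hxdef, hl0]
  have hf0 : (x 0 - D.projL (x 0), a 0 - α) = 0 := by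
    ext1
    · rw [hx0]
      have := D.projL_coe ⟨_, hy01⟩
      simp only at this
      simp [this]
    · simp only [hadef, adStarL_apply, iStarL_apply, hy02, Prod.snd_zero]
      have h : D.lieL.adStar (D.projL (x 0)) 0 = 0 := ContinuousLinearMap.zero_comp _
      rw [h, sub_zero, sub_self]
  have hz := AnalyticOnNhd.eq_zero_of_radial hUc (hU.mem_nhds h0) hf hf0 c
    (differentiableAt_radialMap (hl 0 h0).differentiableAt)
    (by simp [radialMap, radialCoeff_zero hl0])
    (Filter.eventually_of_mem (hU.mem_nhds h0) fun p hp => ?_)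
  · intro p hp
    have h := hz p hp
    have h1 := sub_eq_zero.1 (congrArg Prod.fst h)
    have h2 := sub_eq_zero.1 (congrArg Prod.snd h)
    rw [hadef] at h2
    rw [hxdef] at h1 h2
    exact ⟨h1, h2⟩
  · have hUp := hU.mem_nhds hp
    have hxp : x p = (y p).1 - l p (y p).2 := by rw [hxdef]
    have hap : a p = D.iStar (y p).2 - D.lieL.adStar (D.projL (x p)) p := by rw [hadef]; rfl
    have hxr := radial_fst_sub (hl p hp).differentiableAt (Filter.eventually_of_mem hUp hdyn)
      (Filter.eventually_of_mem hUp hs) (hy p).differentiableAt (hrad p) hxp hap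
    rw [← hxdef] at hxr
    have har := radial_sub_adStar hcα (hy p).differentiableAt (hrad p) (hx p hp).differentiableAt
      (w := l p (y p).2) (by rw [hxp]; abel) hxr
    rw [← hadef, ← hap] at har
    have hxd := (hx p hp).differentiableAt.hasFDerivAt
    have hfd := ((hxd.fun_sub ((D.L.subtypeL.comp D.projL).hasFDerivAt.comp p hxd)).prodMk
        ((ha p hp).differentiableAt.hasFDerivAt.sub_const α)).fderiv
    change fderiv 𝕜 (fun p => (x p - D.projL (x p), a p - α)) p = _ at hfd
    rw [hfd, radialMap_apply]
    ext1
    -- The extra term p_L(l_p y₂) of `radial_fst_sub` lies in L, so it disappears from the M-part.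
    · have hxr' := eq_sub_of_add_eq hxr
      simp only [Prod.fst_add, Prod.smul_fst, ContinuousLinearMap.prod_apply, sub_apply,
        ContinuousLinearMap.comp_apply, hxr', map_sub, map_add, map_smul, Submodule.subtypeL_apply,
        projL_coe, smul_sub]
      abel
    · exact har

end LieQuasiBialgebra.ReductiveDecomposition

/-! ### Auxiliary linear algebra. -/

theorem IsLinearMap.surjective_of_injective {K V W : Type*} [Field K] [AddCommGroup V] [Module K V]
    [AddCommGroup W] [Module K W] [FiniteDimensional K V] [FiniteDimensional K W] {f : V → W}
    (hf : IsLinearMap K f) (hfi : Function.Injective f) {g : W → V} (hg : IsLinearMap K g)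
    (hgi : Function.Injective g) : Function.Surjective f := by
  have h1 := LinearMap.finrank_le_finrank_of_injective (f := hf.mk' f) hfi
  have h2 := LinearMap.finrank_le_finrank_of_injective (f := hg.mk' g) hgi
  exact (LinearMap.injective_iff_surjective_of_finrank_eq_finrank (f := hf.mk' f)
    (h1.antisymm h2)).1 hfi

theorem NormedSpace.zero_smul_clm {𝕜 V W : Type*} [RCLike 𝕜] [NormedAddCommGroup V]
    [NormedSpace 𝕜 V] [NormedAddCommGroup W] [NormedSpace 𝕜 W] (v : V →L[𝕜] W) :
    (0 : 𝕜) • v = 0 := zero_smul 𝕜 v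

namespace LieQuasiBialgebra.ReductiveDecomposition

variable {𝕜 𝔤 : Type*} [RCLike 𝕜] [NormedAddCommGroup 𝔤] [NormedSpace 𝕜 𝔤]
  [FiniteDimensional 𝕜 𝔤] {Q : LieQuasiBialgebra 𝕜 𝔤} {D : Q.ReductiveDecomposition}
  {U : Set (StrongDual 𝕜 D.L)} {l : StrongDual 𝕜 D.L → StrongDual 𝕜 𝔤 →L[𝕜] 𝔤}

/-! ### The embedding of `N(U)` into the double -/

/-- The embedding `(z, ξ) ↦ τ_{l_p} (z + ξ)` of `N(U)` into the double. -/
def iota (t : StrongDual 𝕜 𝔤 →L[𝕜] 𝔤) (v : D.L × StrongDual 𝕜 𝔤) : 𝔤 × StrongDual 𝕜 𝔤 :=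
  tau t ((v.1 : 𝔤), v.2)

theorem iota_apply (t : StrongDual 𝕜 𝔤 →L[𝕜] 𝔤) (v : D.L × StrongDual 𝕜 𝔤) :
    D.iota t v = ((v.1 : 𝔤) + t v.2, v.2) := rfl

theorem iota_injective (t : StrongDual 𝕜 𝔤 →L[𝕜] 𝔤) : Function.Injective (D.iota t) := by
  intro v w h
  have h2 : v.2 = w.2 := congrArg (Prod.snd (α := 𝔤) (β := StrongDual 𝕜 𝔤)) h
  have h1 : (v.1 : 𝔤) + t v.2 = w.1 + t w.2 := congrArg (Prod.fst (α := 𝔤) (β := StrongDual 𝕜 𝔤)) h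
  rw [h2, add_left_inj] at h1
  exact Prod.ext (Subtype.ext h1) h2

theorem T_eq (p : StrongDual 𝕜 D.L) (v : StrongDual 𝕜 D.L × D.gStarSubmodule)
    {Y : 𝔤 × StrongDual 𝕜 𝔤} (hY : Y = D.omega p v.1 - D.AdExp p v.2) :
    D.T l p v = (D.projL (Y.1 - l p Y.2), Y.2) := by
  rw [T_apply, hY]
  ext1
  · simp only [u, tau, ← map_sub]
    congr 1
    simp
    abel
  · rfl

/-- The isomorphism `(z, ξ) ↦ (i^* ξ, z + (ξ - s i^* ξ))`. -/
def splitDual (D : Q.ReductiveDecomposition) (w : D.L × StrongDual 𝕜 𝔤) :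
    StrongDual 𝕜 D.L × D.gStarSubmodule :=
  (D.iStar w.2, ⟨((w.1 : 𝔤), w.2 - D.s (D.iStar w.2)), w.1.2, fun z hz => by
    have : D.projL z = ⟨z, hz⟩ := D.projL_coe ⟨z, hz⟩
    simp [s_apply, iStar_apply, this]⟩)

theorem isLinearMap_splitDual (D : Q.ReductiveDecomposition) : IsLinearMap 𝕜 D.splitDual := by
  constructor
  · intro v w
    refine Prod.ext rfl (Subtype.ext (Prod.ext rfl ?_))
    ext y
    change (v.2 y + w.2 y) - (v.2 (D.projL y) + w.2 (D.projL y)) =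
      (v.2 y - v.2 (D.projL y)) + (w.2 y - w.2 (D.projL y))
    ring
  · intro c v
    refine Prod.ext rfl (Subtype.ext (Prod.ext rfl ?_))
    ext y
    change c * v.2 y - c * v.2 (D.projL y) = c * (v.2 y - v.2 (D.projL y))
    ring

theorem splitDual_injective (D : Q.ReductiveDecomposition) :
    Function.Injective D.splitDual := by
  intro v w h
  have h1 : D.iStar v.2 = D.iStar w.2 := congrArg Prod.fst h
  have h2 : (((v.1 : 𝔤), v.2 - D.s (D.iStar v.2)) : 𝔤 × StrongDual 𝕜 𝔤) =
    ((w.1 : 𝔤), w.2 - D.s (D.iStar w.2)) := congrArg (fun x => (x.2 : 𝔤 × StrongDual 𝕜 𝔤)) h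
  rw [h1] at h2
  exact Prod.ext (Subtype.ext (congrArg Prod.fst h2)) (sub_left_injective (congrArg Prod.snd h2))

theorem isLinearMap_T (p : StrongDual 𝕜 D.L) : IsLinearMap 𝕜 (D.T l p) :=
  ⟨(D.T l p).map_add, (D.T l p).map_smul⟩

section Canonical

variable (hU : IsOpen U) (hUc : IsPreconnected U) (h0 : (0 : StrongDual 𝕜 D.L) ∈ U)
  (hl : AnalyticOnNhd 𝕜 l U) (hdyn : ∀ p ∈ U, D.IsDynamicalAt l p)
  (hs : ∀ p ∈ U, l p (D.s p) = 0) (hl0 : l 0 = 0)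
include hU hUc h0 hl hdyn hs hl0

/-- The radial argument with c = 0 and no source: the initial conditions say exactly that X lies in
L ⊕ L^⊥. -/
theorem AdExp_mem (X : D.gStarSubmodule) {p : StrongDual 𝕜 D.L} (hp : p ∈ U) :
    (D.AdExp p X).1 - l p (D.AdExp p X).2 = D.projL ((D.AdExp p X).1 - l p (D.AdExp p X).2) ∧
      D.iStar (D.AdExp p X).2
        - D.lieL.adStar (D.projL ((D.AdExp p X).1 - l p (D.AdExp p X).2)) p = 0 := by
  have : CompleteSpace 𝔤 := FiniteDimensional.complete 𝕜 𝔤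
  have hX0 : D.AdExp 0 (X : 𝔤 × StrongDual 𝕜 𝔤) = X := by
    rw [AdExp_eq]
    exact Q.double.expSeriesSum_ad_zero D.sDouble _
  refine eq_zero_of_radial_double hU hUc h0 hl hdyn hs hl0 (y := fun q => D.AdExp q X)
    (fun q => Q.double.analyticAt_expSeriesSum_ad_apply D.sDouble _ q) (α := 0) 0
    (by rw [Nat.cast_zero]; exact NormedSpace.zero_smul_clm _)
    (fun q => ?_) ?_ ?_ p hp
  · have h := Q.double.radial_expSeriesSum D.sDouble q X
    change fderiv 𝕜 (fun q => D.AdExp q X) q q = D.adS q (D.AdExp q X) at h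
    have h2 : ((0 : ℕ) : 𝕜) • D.AdExp q (X : 𝔤 × StrongDual 𝕜 𝔤) = 0 := by ext <;> simp
    rw [h, h2, map_zero]
  · simp only [hX0]
    exact X.2.1
  · simp only [hX0]
    ext z
    exact X.2.2 z z.2

/-- The radial argument with c = 1 and source s α, starting from ω_0 α = s α. -/
theorem omega_mem (α : StrongDual 𝕜 D.L) {p : StrongDual 𝕜 D.L} (hp : p ∈ U) :
    (D.omega p α).1 - l p (D.omega p α).2 = D.projL ((D.omega p α).1 - l p (D.omega p α).2) ∧
      D.iStar (D.omega p α).2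
        - D.lieL.adStar (D.projL ((D.omega p α).1 - l p (D.omega p α).2)) p = α := by
  have : CompleteSpace 𝔤 := FiniteDimensional.complete 𝕜 𝔤
  have hα0 : D.omega 0 α = (0, D.s α) := Q.double.expOmega_zero D.sDouble α
  refine eq_zero_of_radial_double hU hUc h0 hl hdyn hs hl0 (y := fun q => D.omega q α)
    (fun q => Q.double.analyticAt_expOmega D.sDouble q α) 1 (by simp)
    (fun q => ?_) ?_ ?_ p hp
  · have h := Q.double.radial_expOmega D.sDouble q α
    simp only [← omega_eq, ← adS_eq] at h
    simp [h]
  · simp [hα0]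
  · simp [hα0]

/-- The 𝔤-part of τ_{-l_p}(ω_p α - Ad_p X) already lies in L, so the projection in T loses nothing
and τ_{l_p} undoes τ_{-l_p}. -/
theorem iota_T {p : StrongDual 𝕜 D.L} (hp : p ∈ U) (v : StrongDual 𝕜 D.L × D.gStarSubmodule) :
    D.iota (l p) (D.T l p v) = D.omega p v.1 - D.AdExp p v.2 := by
  have h1 := (AdExp_mem hU hUc h0 hl hdyn hs hl0 v.2 hp).1
  have h2 := (omega_mem hU hUc h0 hl hdyn hs hl0 v.1 hp).1
  rw [T_eq p v rfl, iota_apply]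
  ext1
  · have e : (D.omega p v.1 - D.AdExp p v.2).1 - l p (D.omega p v.1 - D.AdExp p v.2).2 =
        ((D.omega p v.1).1 - l p (D.omega p v.1).2)
          - ((D.AdExp p v.2).1 - l p (D.AdExp p v.2).2) := by
      simp
      abel
    have h3 : (D.projL ((D.omega p v.1 - D.AdExp p v.2).1
        - l p (D.omega p v.1 - D.AdExp p v.2).2) : 𝔤) =
        (D.omega p v.1 - D.AdExp p v.2).1 - l p (D.omega p v.1 - D.AdExp p v.2).2 := by
      rw [e, map_sub, Submodule.coe_sub, ← h1, ← h2]
    simp only [h3, sub_add_cancel]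
  · rfl

theorem anchorN_T {p : StrongDual 𝕜 D.L} (hp : p ∈ U)
    (v : StrongDual 𝕜 D.L × D.gStarSubmodule) : D.anchorN p (D.T l p v) = v.1 := by
  have h1 := (AdExp_mem hU hUc h0 hl hdyn hs hl0 v.2 hp).2
  have h2 := (omega_mem hU hUc h0 hl hdyn hs hl0 v.1 hp).2
  have e : D.T l p v =
      (D.projL ((D.omega p v.1).1 - l p (D.omega p v.1).2), (D.omega p v.1).2) -
      (D.projL ((D.AdExp p v.2).1 - l p (D.AdExp p v.2).2), (D.AdExp p v.2).2) := by
    rw [T_eq p v rfl]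
    ext1
    · simp only [Prod.fst_sub, Prod.snd_sub, map_sub]
      abel
    · rfl
  rw [e, map_sub, anchorN_apply, anchorN_apply, h1, h2, sub_zero]

/-- The anchor recovers α; once α = 0, the embedding leaves -Ad_p X, and Ad_p is invertible. -/
theorem T_injective {p : StrongDual 𝕜 D.L} (hp : p ∈ U) : Function.Injective (D.T l p) := by
  have : CompleteSpace 𝔤 := FiniteDimensional.complete 𝕜 𝔤
  have hker : ∀ v, D.T l p v = 0 → v = 0 := by
    intro v hv
    have h1 := anchorN_T hU hUc h0 hl hdyn hs hl0 hp v
    have h2 := iota_T hU hUc h0 hl hdyn hs hl0 hp v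
    rw [hv, map_zero] at h1
    have hι : D.iota (l p) 0 = 0 := by ext1 <;> simp [iota_apply]
    have hω : D.omega p 0 = 0 := by
      change expSubOneDiv (D.adS p) (D.sDouble 0) = 0
      rw [map_zero, map_zero]
    rw [hv, ← h1, hι, hω, zero_sub, eq_comm, neg_eq_zero] at h2
    exact Prod.ext h1.symm (Subtype.ext (eq_zero_of_expSeriesSum_apply_eq_zero _ h2))
  exact fun v w hvw =>
    sub_eq_zero.1 (hker _ (((D.T l p).map_sub v w).trans (sub_eq_zero.2 hvw)))

/-- `splitDual` serves only to compare dimensions: linear injections in both directions force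
equality. -/
theorem T_bijective {p : StrongDual 𝕜 D.L} (hp : p ∈ U) : Function.Bijective (D.T l p) := by
  have hinj := T_injective hU hUc h0 hl hdyn hs hl0 hp
  refine ⟨hinj, ?_⟩
  have h := isLinearMap_T (l := l) p
  have h2 := D.isLinearMap_splitDual
  have h3 := D.splitDual_injective
  generalize D.splitDual = g at h2 h3
  generalize (⇑(D.T l p)) = f at *
  exact IsLinearMap.surjective_of_injective h hinj h2 h3

end Canonical
end LieQuasiBialgebra.ReductiveDecomposition

theorem DifferentiableAt.coe_submodule {𝕜 E V : Type*} [RCLike 𝕜] [NormedAddCommGroup E]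
    [NormedSpace 𝕜 E] [NormedAddCommGroup V] [NormedSpace 𝕜 V] {S : Submodule 𝕜 V} {f : E → S}
    {p : E} (hf : DifferentiableAt 𝕜 f p) :
    DifferentiableAt 𝕜 (fun q => (f q : V)) p ∧
      ∀ β, fderiv 𝕜 (fun q => (f q : V)) p β = (fderiv 𝕜 f p β : S) := by
  have h := S.subtypeL.hasFDerivAt.comp p hf.hasFDerivAt
  refine ⟨h.differentiableAt, fun β => ?_⟩
  have e := h.fderiv
  change fderiv 𝕜 (fun q => (f q : V)) p = _ at e
  rw [e]
  rfl

namespace LieQuasiBialgebra.ReductiveDecomposition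

variable {𝕜 𝔤 : Type*} [RCLike 𝕜] [NormedAddCommGroup 𝔤] [NormedSpace 𝕜 𝔤]
  [FiniteDimensional 𝕜 𝔤] {Q : LieQuasiBialgebra 𝕜 𝔤} {D : Q.ReductiveDecomposition}
  {U : Set (StrongDual 𝕜 D.L)} {l : StrongDual 𝕜 D.L → StrongDual 𝕜 𝔤 →L[𝕜] 𝔤}

/-! ### The bracket of `N(U)` in the double -/

/-- The tensorial part of the bracket of `N(U)`, embedded into the double. -/
theorem iota_bracket_tensorial {p : StrongDual 𝕜 D.L} (hl : DifferentiableAt 𝕜 l p)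
    (hdyn : ∀ᶠ q in 𝓝 p, D.IsDynamicalAt l q) (v w : D.L × StrongDual 𝕜 𝔤) :
    D.iota (l p) (-D.lieL.bracket v.1 w.1 + (bidualEquiv 𝕜 D.L).symm (D.derivPair l p v.2 w.2),
        Q.adStar v.1 w.2 - Q.adStar w.1 v.2 + Q.coPair v.2 w.2
          + Q.adStar (l p v.2) w.2 - Q.adStar (l p w.2) v.2) =
      (fderiv 𝕜 l p (D.anchorN p v) w.2 - fderiv 𝕜 l p (D.anchorN p w) v.2, 0) -
        Q.double.bracket (D.iota (l p) v) (D.iota (l p) w) := by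
  obtain ⟨z, ξ⟩ := v
  obtain ⟨w, η⟩ := w
  have hp := hdyn.self_of_nhds
  change _ = _ - Q.doubleBracket _ _
  rw [doubleBracket_apply]
  simp only [iota_apply]
  ext1
  · apply (SeparatingDual.eq_iff_forall_dual_eq (R := 𝕜)).2
    intro ζ
    -- The L-valued term of the bracket thus supplies the derivative of l along i^* ζ in the
    -- Yang–Baxter equation.
    have hbid : ζ ((bidualEquiv 𝕜 D.L).symm (D.derivPair l p ξ η) : D.L) =
        ξ (fderiv 𝕜 l p (D.iStar ζ) η) :=
      apply_bidualEquiv_symm (D.derivPair l p ξ η) (D.iStar ζ)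
    have hbr : ζ (D.lieL.bracket z w : D.L) = ζ (Q.bracket z w) := rfl
    have hskew := fderiv_skew hl (hdyn.mono fun q hq => hq.skew)
    -- Equivariance accounts for the derivatives of l along ad^*_z p and ad^*_w p, Yang–Baxter for
    -- those along i^* ξ and i^* η; the rest is skewness.
    have e1 := congrArg ζ (hp.equivariance z η)
    have e2 := congrArg ζ (hp.equivariance w ξ)
    have yb := hp.yangBaxter ξ η ζ
    have s1 := hskew (D.iStar η) ξ ζ
    have s2 := hskew (D.iStar ζ) η ξ
    have s3 := Q.varpi_skew (l p η) ξ ζ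
    have s4 := Q.varpi_skew (l p ζ) η ξ
    have s5 := hp.skew ζ (Q.coPair ξ η)
    have s6 := hp.skew ζ (Q.adStar (l p ξ) η)
    have s7 := hp.skew ζ (Q.adStar (l p η) ξ)
    have b1 : η (Q.bracket (l p ζ) (l p ξ)) = -η (Q.bracket (l p ξ) (l p ζ)) := by
      rw [Q.bracket_skew, map_neg]
    have b2 : ζ (Q.bracket w (l p ξ)) = -ζ (Q.bracket (l p ξ) w) := by
      rw [Q.bracket_skew, map_neg]
    simp only [LieStructure.adStar_apply, coPair_apply] at s5 s6 s7
    simp only [map_add, map_zero] at e1 e2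
    simp only [anchorN_apply, Prod.fst_sub, Submodule.coe_add, Submodule.coe_neg, map_add, map_sub,
      map_neg, add_apply, sub_apply, hbid, hbr]
    linear_combination e1 - e2 - yb + s1 + s2 - s3 - s4 + s5 + s6 - s7 - b1 + b2
  · ext y
    simp
    ring

/-- The embedding of `N(U)` into the double intertwines the brackets. -/
theorem iota_bracket {p : StrongDual 𝕜 D.L} (hl : DifferentiableAt 𝕜 l p)
    (hdyn : ∀ᶠ q in 𝓝 p, D.IsDynamicalAt l q)
    {σ τ : StrongDual 𝕜 D.L → D.L × StrongDual 𝕜 𝔤} (hσ : DifferentiableAt 𝕜 σ p)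
    (hτ : DifferentiableAt 𝕜 τ p) :
    D.iota (l p) ((D.algebroidN l).bracket σ τ p) =
      fderiv 𝕜 (fun q => D.iota (l q) (τ q)) p (D.anchorN p (σ p)) -
      fderiv 𝕜 (fun q => D.iota (l q) (σ q)) p (D.anchorN p (τ p)) -
      Q.double.bracket (D.iota (l p) (σ p)) (D.iota (l p) (τ p)) := by
  -- Differentiating l inside ι produces exactly the derivative terms on the right of
  -- `iota_bracket_tensorial`.
  have hder : ∀ {σ : StrongDual 𝕜 D.L → D.L × StrongDual 𝕜 𝔤}, DifferentiableAt 𝕜 σ p →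
      ∀ β, fderiv 𝕜 (fun q => D.iota (l q) (σ q)) p β =
        (((fderiv 𝕜 (fun q => (σ q).1) p β : D.L) : 𝔤) +
          (fderiv 𝕜 l p β (σ p).2 + l p (fderiv 𝕜 (fun q => (σ q).2) p β)),
          fderiv 𝕜 (fun q => (σ q).2) p β) := by
    intro σ hσ β
    have h1 := hσ.fst.hasFDerivAt
    have h2 := hσ.snd.hasFDerivAt
    have h3 := D.L.subtypeL.hasFDerivAt.comp p h1
    have h4 := ((h3.fun_add (hl.hasFDerivAt.clm_apply h2)).prodMk h2).fderiv
    change fderiv 𝕜 (fun q => D.iota (l q) (σ q)) p = _ at h4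
    rw [h4]
    simp [add_comm]
  have hadd : ∀ v w : D.L × StrongDual 𝕜 𝔤,
      D.iota (l p) (v + w) = D.iota (l p) v + D.iota (l p) w := by
    intro v w
    ext1
    · simp only [iota_apply, Prod.fst_add, Prod.snd_add, Submodule.coe_add, map_add]
      abel
    · rfl
  have hval : (D.algebroidN l).bracket σ τ p =
      (fderiv 𝕜 (fun q => (τ q).1) p (D.anchorN p (σ p))
        - fderiv 𝕜 (fun q => (σ q).1) p (D.anchorN p (τ p)),
      fderiv 𝕜 (fun q => (τ q).2) p (D.anchorN p (σ p))
        - fderiv 𝕜 (fun q => (σ q).2) p (D.anchorN p (τ p))) +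
      (-D.lieL.bracket (σ p).1 (τ p).1
          + (bidualEquiv 𝕜 D.L).symm (D.derivPair l p (σ p).2 (τ p).2),
        Q.adStar (σ p).1 (τ p).2 - Q.adStar (τ p).1 (σ p).2 + Q.coPair (σ p).2 (τ p).2
          + Q.adStar (l p (σ p).2) (τ p).2 - Q.adStar (l p (τ p).2) (σ p).2) := by
    ext1
    · simp only [algebroidN, Prod.fst_add]
      abel
    · simp only [algebroidN, Prod.snd_add]
      abel
  rw [hval, hadd, iota_bracket_tensorial hl hdyn (σ p) (τ p), hder hσ, hder hτ, ← add_sub_assoc]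
  congr 1
  ext1
  · simp only [iota_apply, Prod.fst_add, Prod.fst_sub, Submodule.coe_sub, map_sub]
    abel
  · simp only [iota_apply, Prod.snd_add, Prod.snd_sub, add_zero]

theorem algebroidN_bracket_congr (hU : IsOpen U) (σ σ' τ τ' : StrongDual 𝕜 D.L → D.L × StrongDual 𝕜 𝔤)
    (hσ : Set.EqOn σ σ' U) (hτ : Set.EqOn τ τ' U) :
    Set.EqOn ((D.algebroidN l).bracket σ τ) ((D.algebroidN l).bracket σ' τ') U := by
  intro p hp
  have h1 : ∀ {σ σ' : StrongDual 𝕜 D.L → D.L × StrongDual 𝕜 𝔤}, Set.EqOn σ σ' U →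
      fderiv 𝕜 (fun q => (σ q).1) p = fderiv 𝕜 (fun q => (σ' q).1) p := fun h =>
    fderiv_congr_of_isOpen hU (fun q hq => congrArg Prod.fst (h hq)) hp
  have h2 : ∀ {σ σ' : StrongDual 𝕜 D.L → D.L × StrongDual 𝕜 𝔤}, Set.EqOn σ σ' U →
      fderiv 𝕜 (fun q => (σ q).2) p = fderiv 𝕜 (fun q => (σ' q).2) p := fun h =>
    fderiv_congr_of_isOpen hU (fun q hq => congrArg Prod.snd (h hq)) hp
  simp only [algebroidN]
  rw [h1 hσ, h1 hτ, h2 hσ, h2 hτ, hσ hp, hτ hp]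

theorem analyticAt_omega (p α : StrongDual 𝕜 D.L) : AnalyticAt 𝕜 (fun q => D.omega q α) p := by
  have : CompleteSpace 𝔤 := FiniteDimensional.complete 𝕜 𝔤
  exact Q.double.analyticAt_expOmega D.sDouble p α

theorem analyticAt_AdExp (p : StrongDual 𝕜 D.L) (X : 𝔤 × StrongDual 𝕜 𝔤) :
    AnalyticAt 𝕜 (fun q => D.AdExp q X) p := by
  have : CompleteSpace 𝔤 := FiniteDimensional.complete 𝕜 𝔤
  exact Q.double.analyticAt_expSeriesSum_ad_apply D.sDouble X p

theorem contDiffOn_T_apply (hl : ContDiffOn 𝕜 ∞ l U)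
    (v : StrongDual 𝕜 D.L × D.gStarSubmodule) : ContDiffOn 𝕜 ∞ (fun q => D.T l q v) U := by
  have : CompleteSpace 𝔤 := FiniteDimensional.complete 𝕜 𝔤
  have hY : ContDiffOn 𝕜 ∞ (fun q => D.omega q v.1 - D.AdExp q v.2) U := fun p _ =>
    ((analyticAt_omega p v.1).fun_sub (analyticAt_AdExp p v.2)).contDiffAt.contDiffWithinAt
  have h := (D.projL.contDiff.comp_contDiffOn (hY.fst.sub (hl.clm_apply hY.snd))).prodMk hY.snd
  exact h.congr fun p _ => T_eq p v rfl

theorem differentiableAt_T_section {p : StrongDual 𝕜 D.L} (hl : DifferentiableAt 𝕜 l p)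
    {α : StrongDual 𝕜 D.L → StrongDual 𝕜 D.L} {X : StrongDual 𝕜 D.L → D.gStarSubmodule}
    (hα : DifferentiableAt 𝕜 α p)
    (hX : DifferentiableAt 𝕜 (fun q => (X q : 𝔤 × StrongDual 𝕜 𝔤)) p) :
    DifferentiableAt 𝕜 (fun q => D.T l q (α q, X q)) p := by
  have : CompleteSpace 𝔤 := FiniteDimensional.complete 𝕜 𝔤
  have hY := Q.double.differentiableAt_expOmega_sub D.sDouble hα hX
  have e : (fun q => D.T l q (α q, X q)) = fun q =>
      (D.projL ((D.omega q (α q) - D.AdExp q (X q)).1 - l q (D.omega q (α q) - D.AdExp q (X q)).2),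
        (D.omega q (α q) - D.AdExp q (X q)).2) := by
    ext1 q
    exact T_eq q (α q, X q) rfl
  rw [e]
  exact (D.projL.differentiableAt.comp p (hY.fst.fun_sub (hl.clm_apply hY.snd))).prodMk hY.snd

section Canonical

variable (hU : IsOpen U) (hUc : IsPreconnected U) (h0 : (0 : StrongDual 𝕜 D.L) ∈ U)
  (hl : AnalyticOnNhd 𝕜 l U) (hdyn : ∀ p ∈ U, D.IsDynamicalAt l p)
  (hs : ∀ p ∈ U, l p (D.s p) = 0) (hl0 : l 0 = 0)
include hU hUc h0 hl hdyn hs hl0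

/-- After the injective ι_p is applied, both sides are given by the gauge formula. The identity for
ι ∘ T is available only on U, whose openness lets it be differentiated. -/
theorem T_bracket {σ τ : StrongDual 𝕜 D.L → StrongDual 𝕜 D.L × D.gStarSubmodule}
    (hσ : ContDiffOn 𝕜 ∞ σ U) (hτ : ContDiffOn 𝕜 ∞ τ U) {p : StrongDual 𝕜 D.L} (hp : p ∈ U) :
    D.T l p ((trivialAlgebroid (StrongDual 𝕜 D.L) D.gStar).bracket σ τ p) =
      (D.algebroidN l).bracket (fun q => D.T l q (σ q)) (fun q => D.T l q (τ q)) p := by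
  have : CompleteSpace 𝔤 := FiniteDimensional.complete 𝕜 𝔤
  have hι : ∀ σ : StrongDual 𝕜 D.L → StrongDual 𝕜 D.L × D.gStarSubmodule,
      Set.EqOn (fun q => D.iota (l q) (D.T l q (σ q)))
        (fun q => D.omega q (σ q).1 - D.AdExp q (σ q).2) U := fun σ q hq =>
    iota_T hU hUc h0 hl hdyn hs hl0 hq (σ q)
  have hcoe : ∀ {σ : StrongDual 𝕜 D.L → StrongDual 𝕜 D.L × D.gStarSubmodule},
      ContDiffOn 𝕜 ∞ σ U →
      DifferentiableAt 𝕜 (fun q => ((σ q).2 : 𝔤 × StrongDual 𝕜 𝔤)) p ∧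
        ∀ β, fderiv 𝕜 (fun q => ((σ q).2 : 𝔤 × StrongDual 𝕜 𝔤)) p β =
          (fderiv 𝕜 (fun q => (σ q).2) p β : D.gStarSubmodule) := fun hσ =>
    (hσ.snd.differentiableAt_of_isOpen hU hp).coe_submodule
  have hdT : ∀ {σ : StrongDual 𝕜 D.L → StrongDual 𝕜 D.L × D.gStarSubmodule},
      ContDiffOn 𝕜 ∞ σ U → DifferentiableAt 𝕜 (fun q => D.T l q (σ q)) p := fun hσ =>
    differentiableAt_T_section (hl p hp).differentiableAt
      (hσ.fst.differentiableAt_of_isOpen hU hp) (hcoe hσ).1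
  apply D.iota_injective (l p)
  rw [iota_T hU hUc h0 hl hdyn hs hl0 hp, iota_bracket (hl p hp).differentiableAt
    (Filter.eventually_of_mem (hU.mem_nhds hp) hdyn) (hdT hσ) (hdT hτ),
    fderiv_congr_of_isOpen hU (hι σ) hp, fderiv_congr_of_isOpen hU (hι τ) hp,
    anchorN_T hU hUc h0 hl hdyn hs hl0 hp, anchorN_T hU hUc h0 hl hdyn hs hl0 hp,
    iota_T hU hUc h0 hl hdyn hs hl0 hp, iota_T hU hUc h0 hl hdyn hs hl0 hp]
  have h := Q.double.bracket_gauge D.sDouble (hσ.fst.differentiableAt_of_isOpen hU hp)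
    (hτ.fst.differentiableAt_of_isOpen hU hp) (hcoe hσ).1 (hcoe hτ).1
  rw [(hcoe hσ).2, (hcoe hτ).2] at h
  exact h.symm

end Canonical

end LieQuasiBialgebra.ReductiveDecomposition

end

/-! ### The isomorphism theorem. -/

theorem mainTheorem8 {𝕜 𝔤 : Type*} [RCLike 𝕜] [NormedAddCommGroup 𝔤] [NormedSpace 𝕜 𝔤]
    [FiniteDimensional 𝕜 𝔤] (Q : LieQuasiBialgebra 𝕜 𝔤) (D : Q.ReductiveDecomposition)
    (U : Set (StrongDual 𝕜 D.L)) (hU : IsOpen U) (hUc : IsPreconnected U) (h0 : 0 ∈ U)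
    (l : StrongDual 𝕜 D.L → StrongDual 𝕜 𝔤 →L[𝕜] 𝔤)
    (hl : AnalyticOnNhd 𝕜 l U) (hcan : D.IsCanonical l) :
    (trivialAlgebroid (StrongDual 𝕜 D.L) D.gStar).IsLieAlgebroid U ∧
    (D.algebroidN l).IsLieAlgebroid U ∧
    (trivialAlgebroid (StrongDual 𝕜 D.L) D.gStar).IsIsomorphism (D.algebroidN l) U (D.T l) := by
  have hdyn := LieQuasiBialgebra.ReductiveDecomposition.isDynamicalAt_of_isPreconnected hUc h0 hl
    hcan.dynamical
  have hs := LieQuasiBialgebra.ReductiveDecomposition.apply_s_of_isPreconnected hUc h0 hl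
    hcan.apply_s
  have hmor : (trivialAlgebroid (StrongDual 𝕜 D.L) D.gStar).IsMorphism (D.algebroidN l) U (D.T l) :=
    .of_contDiffOn_apply
      (LieQuasiBialgebra.ReductiveDecomposition.contDiffOn_T_apply
        (hl.contDiffOn hU.uniqueDiffOn))
      (fun p hp =>
        LieQuasiBialgebra.ReductiveDecomposition.anchorN_T hU hUc h0 hl hdyn hs hcan.zero hp)
      (fun σ τ hσ hτ p hp =>
        LieQuasiBialgebra.ReductiveDecomposition.T_bracket hU hUc h0 hl hdyn hs hcan.zero hσ hτ hp)
  have hbij : ∀ p ∈ U, Function.Bijective (D.T l p) := fun p hp =>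
    LieQuasiBialgebra.ReductiveDecomposition.T_bijective hU hUc h0 hl hdyn hs hcan.zero hp
  have htriv := trivialAlgebroid_isLieAlgebroid (E := StrongDual 𝕜 D.L) hU D.gStar
  exact ⟨htriv, hmor.isIsomorphism_of_bijective hU htriv hbij
    (LieQuasiBialgebra.ReductiveDecomposition.algebroidN_bracket_congr hU)⟩
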